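/- For $\rho\in\mathbb R$ let $M^2(\rho)$ be the 2-dimensional space form of constant curvature $\rho$: the Euclidean plane $\mathbb R^2$ if $\rho=0$; the hyperbolic plane $\mathbb H^2(\rho)$ if $\rho<0$, i.e. the disc $\{(x,y): 1+\frac{\rho}{4}(x^2+y^2)>0\}$ with the metric $(dx^2+dy^2)/(1+\frac{\rho}{4}(x^2+y^2))^2$; the round sphere $\mathbb S^2(\rho)\subset\mathbb R^3$ of radius $1/\sqrt\rho$ with the induced metric if $\rho>0$. Let $\nabla$ be its Levi-Civita connection, $R(X,Y)Z=\nabla_X\nabla_YZ-\nabla_Y\nabla_XZ-\nabla_{[X,Y]}Z$ its curvature tensor, and $J$ the rotation by $\pi/2$ in its tangent planes. Let $I\subset\mathbb R$ be an open interval and $\gamma:I\to M^2(\rho)$ a smooth curve parametrized by arc length, with unit tangent field $T=\gamma'$ and geodesic curvature $\kappa_g$, defined by $\nabla_TT=\kappa_g\,JT$. The curve $\gamma$ is called triharmonic if $$\nabla_T^5T+R(\nabla_T^3T,T)T-R(\nabla_T^2T,\nabla_TT)T=0 .$$ (i) If $\rho\le 0$, then $\gamma$ is triharmonic if and only if it is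 a geodesic ($\nabla_TT=0$). (ii) If $\rho>0$, then $\gamma$ is triharmonic if and only if it is a geodesic, or its image lies on a circle of the sphere (the set of points at a constant positive distance from some point of the sphere) and $\kappa_g^2=2\rho$ along $\gamma$. -/

import Mathlib

open scoped ContDiff

namespace Triharmonic

noncomputable section

/-! ### Riemannian geometry in coordinates

`g` is the matrix of a Riemannian metric in local coordinates on (an open subset of) `ℝⁿ`,
`c` is a curve written in these coordinates. -/

section Coordinates

variable {n : ℕ}

/-- The `i`-th partial derivative of a real function on `ℝⁿ`. -/
def pderiv (i : Fin n) (f : (Fin n → ℝ) → ℝ) (x : Fin n → ℝ) : ℝ :=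
  fderiv ℝ f x (Pi.single i 1)

/-- The scalar product `g_x(v, w)`. -/
def scal (g : (Fin n → ℝ) → Matrix (Fin n) (Fin n) ℝ) (x v w : Fin n → ℝ) : ℝ :=
  ∑ i, ∑ j, g x i j * v i * w j

/-- The Christoffel symbol `Γᵏᵢⱼ` of the Levi-Civita connection of `g`. -/
def christoffel (g : (Fin n → ℝ) → Matrix (Fin n) (Fin n) ℝ) (k i j : Fin n)
    (x : Fin n → ℝ) : ℝ :=
  (1 / 2) * ∑ l, (g x)⁻¹ k l *
    (pderiv i (fun y => g y j l) x + pderiv j (fun y => g y i l) x - pderiv l (fun y => g y i j) x)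

/-- The `l`-th component of `R(∂ᵢ, ∂ⱼ)∂ₖ`, where
`R(X, Y)Z = ∇_X ∇_Y Z - ∇_Y ∇_X Z - ∇_[X, Y] Z`. -/
def riemannComp (g : (Fin n → ℝ) → Matrix (Fin n) (Fin n) ℝ) (l i j k : Fin n)
    (x : Fin n → ℝ) : ℝ :=
  pderiv i (christoffel g l j k) x - pderiv j (christoffel g l i k) x
    + ∑ m, (christoffel g m j k x * christoffel g l i m x
      - christoffel g m i k x * christoffel g l j m x)

/-- The Riemannian curvature tensor `R_x(X, Y)Z`. -/
def riemann (g : (Fin n → ℝ) → Matrix (Fin n) (Fin n) ℝ) (x X Y Z : Fin n → ℝ) : Fin n → ℝ :=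
  fun l => ∑ i, ∑ j, ∑ k, riemannComp g l i j k x * X i * Y j * Z k

/-- The covariant derivative `∇_T V` of a vector field `V` along the curve `c`, `T = c'`. -/
def covDeriv (g : (Fin n → ℝ) → Matrix (Fin n) (Fin n) ℝ) (c V : ℝ → Fin n → ℝ) :
    ℝ → Fin n → ℝ :=
  fun s k => deriv V s k + ∑ i, ∑ j, christoffel g k i j (c s) * deriv c s i * V s j

/-- The iterated covariant derivative `∇_Tᵐ T` of the velocity `T = c'`. -/
def covIter (g : (Fin n → ℝ) → Matrix (Fin n) (Fin n) ℝ) (c : ℝ → Fin n → ℝ) (m : ℕ) :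
    ℝ → Fin n → ℝ :=
  (covDeriv g c)^[m] (deriv c)

/-- The 3-tension field
`τ₃ = ∇_T⁵ T + R(∇_T³ T, T) T - R(∇_T² T, ∇_T T) T` of the curve `c`. -/
def tension3 (g : (Fin n → ℝ) → Matrix (Fin n) (Fin n) ℝ) (c : ℝ → Fin n → ℝ) (s : ℝ) :
    Fin n → ℝ :=
  covIter g c 5 s
    + riemann g (c s) (covIter g c 3 s) (covIter g c 0 s) (covIter g c 0 s)
    - riemann g (c s) (covIter g c 2 s) (covIter g c 1 s) (covIter g c 0 s)

/-- The counter-clockwise rotation `J` by `π / 2` with respect to a metric on `ℝ²`. -/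
def rotJ (g : (Fin 2 → ℝ) → Matrix (Fin 2) (Fin 2) ℝ) (x v : Fin 2 → ℝ) : Fin 2 → ℝ :=
  (1 / √(g x).det) • ![-(g x 1 0 * v 0 + g x 1 1 * v 1), g x 0 0 * v 0 + g x 0 1 * v 1]

/-- The geodesic curvature of a unit speed curve: `κ_g = ⟨∇_T T, J T⟩`,
that is `∇_T T = κ_g J T`. -/
def geodCurv (g : (Fin 2 → ℝ) → Matrix (Fin 2) (Fin 2) ℝ) (c : ℝ → Fin 2 → ℝ) (s : ℝ) : ℝ :=
  scal g (c s) (covIter g c 1 s) (rotJ g (c s) (covIter g c 0 s))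

/-- The Jacobian matrix of a map `ℝ² → ℝ²`. -/
def jacobian (f : (Fin 2 → ℝ) → (Fin 2 → ℝ)) (x : Fin 2 → ℝ) : Matrix (Fin 2) (Fin 2) ℝ :=
  Matrix.of fun a b => fderiv ℝ f x (Pi.single b 1) a

/-- The first fundamental form `⟨∂ₐφ, ∂_bφ⟩` of a parametrization `φ : ℝ² → ℝ³`. -/
def firstFundamentalForm (φ : (Fin 2 → ℝ) → EuclideanSpace ℝ (Fin 3)) (x : Fin 2 → ℝ) :
    Matrix (Fin 2) (Fin 2) ℝ :=
  Matrix.of fun a b =>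
    inner ℝ (fderiv ℝ φ x (Pi.single a 1)) (fderiv ℝ φ x (Pi.single b 1))

end Coordinates

/-! ### Oriented Riemannian surfaces and curves in them -/

/-- An oriented smooth Riemannian surface structure on the space `M`: an oriented smooth atlas,
with the matrix of the metric in every chart. -/
structure RiemannianSurface (M : Type) [TopologicalSpace M] where
  ι : Type
  chart : ι → OpenPartialHomeomorph M (Fin 2 → ℝ)
  metric : ι → (Fin 2 → ℝ) → Matrix (Fin 2) (Fin 2) ℝ
  cover : ∀ p : M, ∃ i, p ∈ (chart i).source
  contDiffOn_transition : ∀ i j, ContDiffOn ℝ ∞ (chart j ∘ (chart i).symm)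
    ((chart i).symm.trans (chart j)).source
  oriented : ∀ i j, ∀ x ∈ ((chart i).symm.trans (chart j)).source,
    0 < (jacobian (chart j ∘ (chart i).symm) x).det
  contDiffOn_metric : ∀ i a b, ContDiffOn ℝ ∞ (fun x => metric i x a b) (chart i).target
  posDef_metric : ∀ i, ∀ x ∈ (chart i).target, (metric i x).PosDef
  metric_transition : ∀ i j, ∀ x ∈ ((chart i).symm.trans (chart j)).source,
    metric i x = (jacobian (chart j ∘ (chart i).symm) x).transpose
      * metric j ((chart j ∘ (chart i).symm) x) * jacobian (chart j ∘ (chart i).symm) x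

namespace RiemannianSurface

variable {M : Type} [TopologicalSpace M]

/-- The curve `γ` in the coordinates of the chart `i`; meaningful where `γ s` is in its domain. -/
def coord (S : RiemannianSurface M) (i : S.ι) (γ : ℝ → M) : ℝ → Fin 2 → ℝ :=
  fun s => S.chart i (γ s)

/-- `γ` restricted to the open set `I` is a smooth curve parametrized by arc length. -/
structure IsArcLengthCurve (S : RiemannianSurface M) (γ : ℝ → M) (I : Set ℝ) : Prop where
  continuousOn : ContinuousOn γ I
  smooth : ∀ i, ContDiffOn ℝ ∞ (S.coord i γ) (I ∩ γ ⁻¹' (S.chart i).source)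
  unit_speed : ∀ i, ∀ s ∈ I, γ s ∈ (S.chart i).source →
    scal (S.metric i) (S.coord i γ s) (deriv (S.coord i γ) s) (deriv (S.coord i γ) s) = 1

/-- `γ` solves `τ₃(γ) = 0` on `I`. -/
def IsTriharmonic (S : RiemannianSurface M) (γ : ℝ → M) (I : Set ℝ) : Prop :=
  ∀ i, ∀ s ∈ I, γ s ∈ (S.chart i).source → tension3 (S.metric i) (S.coord i γ) s = 0

/-- `γ` solves the geodesic equation `∇_T T = 0` on `I`. -/
def IsGeodesic (S : RiemannianSurface M) (γ : ℝ → M) (I : Set ℝ) : Prop :=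
  ∀ i, ∀ s ∈ I, γ s ∈ (S.chart i).source → covIter (S.metric i) (S.coord i γ) 1 s = 0

/-- The square of the geodesic curvature of `γ` is constantly `a` on `I`. -/
def HasGeodCurvSq (S : RiemannianSurface M) (γ : ℝ → M) (I : Set ℝ) (a : ℝ) : Prop :=
  ∀ i, ∀ s ∈ I, γ s ∈ (S.chart i).source →
    geodCurv (S.metric i) (S.coord i γ) s ^ 2 = a

lemma jacobian_of_eqOn_id {f : (Fin 2 → ℝ) → (Fin 2 → ℝ)} {U : Set (Fin 2 → ℝ)}
    (hU : IsOpen U) (hf : Set.EqOn f id U) {x : Fin 2 → ℝ} (hx : x ∈ U) :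
    jacobian f x = 1 := by
  have h : f =ᶠ[nhds x] id := hf.eventuallyEq_of_mem (hU.mem_nhds hx)
  ext a b
  simp [jacobian, h.fderiv_eq, Matrix.one_apply, Pi.single_apply]

/-- A surface covered by a single chart. -/
def ofChart (e : OpenPartialHomeomorph M (Fin 2 → ℝ)) (he : e.source = Set.univ)
    (g : (Fin 2 → ℝ) → Matrix (Fin 2) (Fin 2) ℝ)
    (hg : ∀ a b, ContDiffOn ℝ ∞ (fun x => g x a b) e.target)
    (hpos : ∀ x ∈ e.target, (g x).PosDef) : RiemannianSurface M where
  ι := Unit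
  chart _ := e
  metric _ := g
  cover p := ⟨(), by simp [he]⟩
  contDiffOn_transition _ _ := by
    refine contDiffOn_id.congr fun x hx => ?_
    exact e.right_inv (by simpa [he] using hx)
  oriented _ _ x hx := by
    have : Set.EqOn (e ∘ e.symm) id e.target := fun y hy => e.right_inv hy
    rw [jacobian_of_eqOn_id e.open_target this (by simpa [he] using hx)]
    simp
  contDiffOn_metric _ := hg
  posDef_metric _ := hpos
  metric_transition _ _ x hx := by
    have hx' : x ∈ e.target := by simpa [he] using hx
    have : Set.EqOn (e ∘ e.symm) id e.target := fun y hy => e.right_inv hy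
    rw [jacobian_of_eqOn_id e.open_target this hx', this hx']
    simp

end RiemannianSurface

/-! ### The 2-dimensional space forms -/

/-- The Euclidean plane, with the metric `dx² + dy²`. -/
def euclideanPlane : RiemannianSurface (EuclideanSpace ℝ (Fin 2)) :=
  .ofChart (EuclideanSpace.equiv (Fin 2) ℝ).toHomeomorph.toOpenPartialHomeomorph rfl
    (fun _ => 1) (fun _ _ => contDiffOn_const) (fun _ _ => Matrix.PosDef.one)

/-- The conformal factor `(1 + ρ (x² + y²) / 4)⁻²` of the metrics of constant curvature `ρ`. -/
def conformalFactor (ρ : ℝ) (x : Fin 2 → ℝ) : ℝ :=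
  1 / (1 + ρ / 4 * (x 0 ^ 2 + x 1 ^ 2)) ^ 2

/-- The underlying disc `{1 + ρ (x² + y²) / 4 > 0}` of the Poincaré model of curvature `ρ < 0`:
the open disc of radius `2 / √(-ρ)`. -/
abbrev PoincareDisc (ρ : ℝ) : Type :=
  {p : EuclideanSpace ℝ (Fin 2) // 0 < 1 + ρ / 4 * (p 0 ^ 2 + p 1 ^ 2)}

/-- The chart of the Poincaré disc given by the coordinates `(x, y)`. -/
def poincareChart (ρ : ℝ) : OpenPartialHomeomorph (PoincareDisc ρ) (Fin 2 → ℝ) where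
  toFun p := p.1.ofLp
  invFun x := if h : 0 < 1 + ρ / 4 * (x 0 ^ 2 + x 1 ^ 2) then ⟨WithLp.toLp 2 x, h⟩
    else ⟨WithLp.toLp 2 0, by simp⟩
  source := Set.univ
  target := {x | 0 < 1 + ρ / 4 * (x 0 ^ 2 + x 1 ^ 2)}
  map_source' p _ := p.2
  map_target' _ _ := trivial
  left_inv' p _ := by
    have := p.2
    simp [this]
  right_inv' x hx := by
    have : 0 < 1 + ρ / 4 * (x 0 ^ 2 + x 1 ^ 2) := hx
    simp [this]
  open_source := isOpen_univ
  open_target := isOpen_lt (by fun_prop) (by fun_prop)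
  continuousOn_toFun := by fun_prop
  continuousOn_invFun := by
    refine Topology.IsInducing.subtypeVal.continuousOn_iff.2 ?_
    have h : Continuous fun x : Fin 2 → ℝ => WithLp.toLp 2 x := by fun_prop
    refine h.continuousOn.congr fun x hx => ?_
    have : 0 < 1 + ρ / 4 * (x 0 ^ 2 + x 1 ^ 2) := hx
    simp [this]

/-- The hyperbolic plane of constant curvature `ρ < 0` (Poincaré disc model),
with the metric `(dx² + dy²) / (1 + ρ (x² + y²) / 4)²`. -/
def hyperbolicPlane (ρ : ℝ) : RiemannianSurface (PoincareDisc ρ) :=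
  .ofChart (poincareChart ρ) rfl (fun x => conformalFactor ρ x • 1)
    (fun a b => by
      have : ContDiffOn ℝ ∞ (conformalFactor ρ) (poincareChart ρ).target := by
        unfold conformalFactor
        refine contDiffOn_const.div (by fun_prop) fun x hx => ?_
        have : 0 < 1 + ρ / 4 * (x 0 ^ 2 + x 1 ^ 2) := hx
        positivity
      simpa using this.mul contDiffOn_const)
    (fun x hx => by
      have : 0 < 1 + ρ / 4 * (x 0 ^ 2 + x 1 ^ 2) := hx
      exact Matrix.PosDef.one.smul (by unfold conformalFactor; positivity))

/-- The round sphere of radius `R` centred at the origin of `ℝ³`. -/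
abbrev Sphere (R : ℝ) : Type := Metric.sphere (0 : EuclideanSpace ℝ (Fin 3)) R

/-- Inverse stereographic projection, from the pole `(0, 0, ε R)` with `ε = ± 1`, of the sphere of
radius `R`; the sign in the second coordinate makes the two projections orientation-compatible. -/
def stereoInv (R : ℝ) (ε : ℤˣ) (x : Fin 2 → ℝ) : EuclideanSpace ℝ (Fin 3) :=
  (x 0 ^ 2 + x 1 ^ 2 + 4 * R ^ 2)⁻¹ • !₂[4 * R ^ 2 * x 0, (ε : ℤ) * (4 * R ^ 2 * x 1),
    (ε : ℤ) * (R * (x 0 ^ 2 + x 1 ^ 2 - 4 * R ^ 2))]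

/-- Stereographic projection from the pole `(0, 0, ε R)`. -/
def stereoFun (R : ℝ) (ε : ℤˣ) (p : EuclideanSpace ℝ (Fin 3)) : Fin 2 → ℝ :=
  (2 * R / (R - (ε : ℤ) * p 2)) • ![p 0, (ε : ℤ) * p 1]

lemma sign_sq (ε : ℤˣ) : ((ε : ℤ) : ℝ) ^ 2 = 1 := by
  rcases Int.units_eq_one_or ε with rfl | rfl <;> simp

lemma mem_sphere_iff {R : ℝ} (hR : 0 < R) (p : EuclideanSpace ℝ (Fin 3)) :
    p ∈ Metric.sphere (0 : EuclideanSpace ℝ (Fin 3)) R ↔ p 0 ^ 2 + p 1 ^ 2 + p 2 ^ 2 = R ^ 2 := by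
  rw [mem_sphere_zero_iff_norm, ← sq_eq_sq₀ (norm_nonneg _) hR.le, EuclideanSpace.real_norm_sq_eq,
    Fin.sum_univ_three]

lemma stereoInv_mem {R : ℝ} (hR : 0 < R) (ε : ℤˣ) (x : Fin 2 → ℝ) :
    stereoInv R ε x ∈ Metric.sphere (0 : EuclideanSpace ℝ (Fin 3)) R := by
  rw [mem_sphere_iff hR]
  have h : x 0 ^ 2 + x 1 ^ 2 + 4 * R ^ 2 ≠ 0 := by positivity
  have e := sign_sq ε
  simp [stereoInv]
  field_simp
  simp only [e]
  ring

lemma stereoInv_two_ne {R : ℝ} (hR : 0 < R) (ε : ℤˣ) (x : Fin 2 → ℝ) :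
    R - (ε : ℤ) * stereoInv R ε x 2 = 8 * R ^ 3 / (x 0 ^ 2 + x 1 ^ 2 + 4 * R ^ 2) := by
  have h : x 0 ^ 2 + x 1 ^ 2 + 4 * R ^ 2 ≠ 0 := by positivity
  have e := sign_sq ε
  simp [stereoInv]
  field_simp
  simp only [e]
  ring

lemma stereoFun_stereoInv {R : ℝ} (hR : 0 < R) (ε : ℤˣ) (x : Fin 2 → ℝ) :
    stereoFun R ε (stereoInv R ε x) = x := by
  have h : x 0 ^ 2 + x 1 ^ 2 + 4 * R ^ 2 ≠ 0 := by positivity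
  have e := sign_sq ε
  unfold stereoFun
  rw [stereoInv_two_ne hR]
  ext i
  fin_cases i <;> simp [stereoInv] <;> field_simp
  · ring
  · simp only [e]
    ring

lemma stereoInv_stereoFun {R : ℝ} (hR : 0 < R) (ε : ℤˣ) (p : Sphere R)
    (hp : R - (ε : ℤ) * p.1 2 ≠ 0) : stereoInv R ε (stereoFun R ε p.1) = p.1 := by
  have hs := (mem_sphere_iff hR p.1).1 p.2
  have e := sign_sq ε
  have hden : (stereoFun R ε p.1 0 ^ 2 + stereoFun R ε p.1 1 ^ 2 + 4 * R ^ 2)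
      = 8 * R ^ 3 / (R - (ε : ℤ) * p.1 2) := by
    simp [stereoFun]
    field_simp
    simp only [e]
    linear_combination 4 * hs + 4 * p.1 2 ^ 2 * e
  have hden' : (stereoFun R ε p.1 0 ^ 2 + stereoFun R ε p.1 1 ^ 2 - 4 * R ^ 2)
      = 8 * R ^ 3 / (R - (ε : ℤ) * p.1 2) - 8 * R ^ 2 := by
    rw [← hden]; ring
  unfold stereoInv
  rw [hden, hden']
  ext i
  fin_cases i <;> simp [stereoFun] <;> field_simp
  · norm_num
  · simp only [e]
    norm_num
  · linear_combination p.1 2 * e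

lemma contDiff_stereoInv {R : ℝ} (hR : 0 < R) (ε : ℤˣ) : ContDiff ℝ ∞ (stereoInv R ε) := by
  have hD : ContDiff ℝ ∞ fun x : Fin 2 → ℝ => (x 0 ^ 2 + x 1 ^ 2 + 4 * R ^ 2)⁻¹ :=
    ContDiff.inv (by fun_prop) fun x => by positivity
  refine hD.smul (contDiff_euclidean.2 fun i => ?_)
  fin_cases i <;> simp <;> fun_prop

lemma contDiffAt_stereoFun {R : ℝ} (ε : ℤˣ) {p : EuclideanSpace ℝ (Fin 3)}
    (hp : R - (ε : ℤ) * p 2 ≠ 0) : ContDiffAt ℝ ∞ (stereoFun R ε) p := by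
  have hD : ContDiffAt ℝ ∞ (fun p : EuclideanSpace ℝ (Fin 3) => 2 * R / (R - (ε : ℤ) * p 2)) p :=
    ContDiffAt.div (by fun_prop) (by fun_prop) hp
  refine hD.smul (contDiffAt_pi.2 fun i => ?_)
  fin_cases i <;> simp <;> fun_prop

lemma fderiv_stereoInv {R : ℝ} (hR : 0 < R) (ε : ℤˣ) (x v : Fin 2 → ℝ) :
    fderiv ℝ (stereoInv R ε) x v =
      (x 0 ^ 2 + x 1 ^ 2 + 4 * R ^ 2)⁻¹ • !₂[4 * R ^ 2 * v 0, (ε : ℤ) * (4 * R ^ 2 * v 1),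
        (ε : ℤ) * (R * (2 * x 0 * v 0 + 2 * x 1 * v 1))]
      - ((2 * x 0 * v 0 + 2 * x 1 * v 1) / (x 0 ^ 2 + x 1 ^ 2 + 4 * R ^ 2)) •
        stereoInv R ε x := by
  have hd : DifferentiableAt ℝ (stereoInv R ε) x :=
    (contDiff_stereoInv hR ε).differentiable (by simp) x
  have h : x 0 ^ 2 + x 1 ^ 2 + 4 * R ^ 2 ≠ 0 := by positivity
  have hl (i : Fin 2) : HasDerivAt (fun t : ℝ => x i + t * v i) (v i) 0 := by
    simpa using ((hasDerivAt_id (0 : ℝ)).mul_const (v i)).const_add (x i)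
  have hq : HasDerivAt (fun t : ℝ => (x 0 + t * v 0) ^ 2 + (x 1 + t * v 1) ^ 2)
      (2 * x 0 * v 0 + 2 * x 1 * v 1) 0 := by
    simpa using ((hl 0).fun_pow 2).fun_add ((hl 1).fun_pow 2)
  have hD : HasDerivAt (fun t : ℝ => ((x 0 + t * v 0) ^ 2 + (x 1 + t * v 1) ^ 2 + 4 * R ^ 2)⁻¹)
      (-(2 * x 0 * v 0 + 2 * x 1 * v 1) / (x 0 ^ 2 + x 1 ^ 2 + 4 * R ^ 2) ^ 2) 0 := by
    simpa using (hq.add_const (4 * R ^ 2)).fun_inv (by simpa using h)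
  have hN (k : Fin 3) : HasDerivAt (fun t : ℝ => (![4 * R ^ 2 * (x 0 + t * v 0),
      (ε : ℤ) * (4 * R ^ 2 * (x 1 + t * v 1)),
      (ε : ℤ) * (R * ((x 0 + t * v 0) ^ 2 + (x 1 + t * v 1) ^ 2 - 4 * R ^ 2))] : Fin 3 → ℝ) k)
      ((![4 * R ^ 2 * v 0, (ε : ℤ) * (4 * R ^ 2 * v 1),
        (ε : ℤ) * (R * (2 * x 0 * v 0 + 2 * x 1 * v 1))] : Fin 3 → ℝ) k) 0 := by
    fin_cases k
    · exact (hl 0).const_mul _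
    · exact ((hl 1).const_mul _).const_mul _
    · exact ((hq.sub_const _).const_mul _).const_mul _
  ext k
  have h1 : HasDerivAt (fun t : ℝ => stereoInv R ε (x + t • v) k)
      (fderiv ℝ (stereoInv R ε) x v k) 0 :=
    (EuclideanSpace.proj (𝕜 := ℝ) k).hasFDerivAt.comp_hasDerivAt 0
      (hd.hasFDerivAt.hasLineDerivAt v)
  have h2 := hD.fun_mul (hN k)
  rw [h1.unique h2]
  simp only [stereoInv]
  fin_cases k <;> simp <;> field_simp <;> ring

lemma inner_eq_three (u v : EuclideanSpace ℝ (Fin 3)) :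
    inner ℝ u v = u 0 * v 0 + u 1 * v 1 + u 2 * v 2 := by
  simp only [PiLp.inner_apply, Fin.sum_univ_three, RCLike.inner_apply, conj_trivial]
  ring

/-- The metric induced on the sphere is conformal in stereographic coordinates. -/
lemma firstFundamentalForm_stereoInv {R : ℝ} (hR : 0 < R) (ε : ℤˣ) (x : Fin 2 → ℝ) :
    firstFundamentalForm (stereoInv R ε) x = conformalFactor (1 / R ^ 2) x • 1 := by
  have h : x 0 ^ 2 + x 1 ^ 2 + 4 * R ^ 2 ≠ 0 := by positivity
  have e := sign_sq ε
  have hc : 1 + 1 / R ^ 2 / 4 * (x 0 ^ 2 + x 1 ^ 2)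
      = (x 0 ^ 2 + x 1 ^ 2 + 4 * R ^ 2) / (4 * R ^ 2) := by
    field_simp
    ring
  ext a b
  simp only [firstFundamentalForm, Matrix.of_apply, fderiv_stereoInv hR, conformalFactor, hc,
    inner_eq_three]
  fin_cases a <;> fin_cases b <;>
    simp [stereoInv] <;> field_simp <;>
    (try simp only [e]) <;> ring

/-- Stereographic projection as a chart of the sphere of radius `R`. -/
def stereoChart {R : ℝ} (hR : 0 < R) (ε : ℤˣ) : OpenPartialHomeomorph (Sphere R) (Fin 2 → ℝ) where
  toFun p := stereoFun R ε p.1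
  invFun x := ⟨stereoInv R ε x, stereoInv_mem hR ε x⟩
  source := {p | R - (ε : ℤ) * p.1 2 ≠ 0}
  target := Set.univ
  map_source' _ _ := trivial
  map_target' x _ := by
    simp only [ne_eq, Set.mem_ofPred_eq, stereoInv_two_ne hR]
    positivity
  left_inv' p hp := Subtype.ext (stereoInv_stereoFun hR ε p hp)
  right_inv' x _ := stereoFun_stereoInv hR ε x
  open_source := isOpen_ne_fun (by fun_prop) (by fun_prop)
  open_target := isOpen_univ
  continuousOn_toFun p hp :=
    ((contDiffAt_stereoFun ε hp).continuousAt.comp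
      continuous_subtype_val.continuousAt).continuousWithinAt
  continuousOn_invFun :=
    ((contDiff_stereoInv hR ε).continuous.subtype_mk _).continuousOn

lemma firstFundamentalForm_comp {φ : (Fin 2 → ℝ) → EuclideanSpace ℝ (Fin 3)}
    {f : (Fin 2 → ℝ) → (Fin 2 → ℝ)} {x : Fin 2 → ℝ}
    (hφ : DifferentiableAt ℝ φ (f x)) (hf : DifferentiableAt ℝ f x) :
    firstFundamentalForm (φ ∘ f) x =
      (jacobian f x).transpose * firstFundamentalForm φ (f x) * jacobian f x := by
  have key (w : Fin 2 → ℝ) : fderiv ℝ φ (f x) w =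
      w 0 • fderiv ℝ φ (f x) (Pi.single 0 1) + w 1 • fderiv ℝ φ (f x) (Pi.single 1 1) := by
    rw [← map_smul, ← map_smul, ← map_add]
    congr 1
    ext i
    fin_cases i <;> simp
  ext a b
  simp only [firstFundamentalForm, Matrix.of_apply, fderiv_comp x hφ hf, Matrix.mul_apply,
    Fin.sum_univ_two, Matrix.transpose_apply, jacobian, ContinuousLinearMap.comp_apply]
  rw [key (fderiv ℝ f x (Pi.single a 1)), key (fderiv ℝ f x (Pi.single b 1))]
  simp only [inner_add_left, inner_add_right, real_inner_smul_left, real_inner_smul_right]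
  ring

lemma stereo_transition_neg {R : ℝ} (hR : 0 < R) (ε : ℤˣ) (x : Fin 2 → ℝ)
    (hx : R - ((-ε : ℤˣ) : ℤ) * stereoInv R ε x 2 ≠ 0) :
    x 0 ^ 2 + x 1 ^ 2 ≠ 0 ∧ stereoFun R (-ε) (stereoInv R ε x) =
      (4 * R ^ 2 / (x 0 ^ 2 + x 1 ^ 2)) • ![x 0, -x 1] := by
  have h : x 0 ^ 2 + x 1 ^ 2 + 4 * R ^ 2 ≠ 0 := by positivity
  have e := sign_sq ε
  have hden : R - ((-ε : ℤˣ) : ℤ) * stereoInv R ε x 2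
      = 2 * R * (x 0 ^ 2 + x 1 ^ 2) / (x 0 ^ 2 + x 1 ^ 2 + 4 * R ^ 2) := by
    simp [stereoInv]
    field_simp
    simp only [e]
    ring
  have hq : x 0 ^ 2 + x 1 ^ 2 ≠ 0 := by
    intro h0
    rw [hden, h0] at hx
    simp at hx
  refine ⟨hq, ?_⟩
  unfold stereoFun
  rw [hden]
  ext i
  fin_cases i <;> simp [stereoInv] <;> field_simp
  simp only [e, mul_one]

lemma jacobian_inversion_det {R : ℝ} (hR : 0 < R) {x : Fin 2 → ℝ}
    (hq : x 0 ^ 2 + x 1 ^ 2 ≠ 0) :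
    0 < (jacobian (fun x : Fin 2 → ℝ =>
      (4 * R ^ 2 / (x 0 ^ 2 + x 1 ^ 2)) • (![x 0, -x 1] : Fin 2 → ℝ)) x).det := by
  set f : (Fin 2 → ℝ) → (Fin 2 → ℝ) :=
    fun x => (4 * R ^ 2 / (x 0 ^ 2 + x 1 ^ 2)) • (![x 0, -x 1] : Fin 2 → ℝ) with hf
  have hd : DifferentiableAt ℝ f x := by
    have hD : DifferentiableAt ℝ (fun x : Fin 2 → ℝ => 4 * R ^ 2 / (x 0 ^ 2 + x 1 ^ 2)) x := by
      have hq' : DifferentiableAt ℝ (fun x : Fin 2 → ℝ => x 0 ^ 2 + x 1 ^ 2) x := by fun_prop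
      have hc : DifferentiableAt ℝ (fun _ : Fin 2 → ℝ => 4 * R ^ 2) x := differentiableAt_const _
      have hi := hq'.fun_inv hq
      exact hc.fun_mul hi
    refine hD.fun_smul (differentiableAt_pi.2 fun i => ?_)
    fin_cases i <;> simp <;> fun_prop
  have hl (v : Fin 2 → ℝ) (i : Fin 2) : HasDerivAt (fun t : ℝ => x i + t * v i) (v i) 0 := by
    simpa using ((hasDerivAt_id (0 : ℝ)).mul_const (v i)).const_add (x i)
  have hD (v : Fin 2 → ℝ) : HasDerivAt
      (fun t : ℝ => 4 * R ^ 2 * ((x 0 + t * v 0) ^ 2 + (x 1 + t * v 1) ^ 2)⁻¹)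
      (4 * R ^ 2 * (-(2 * x 0 * v 0 + 2 * x 1 * v 1) / (x 0 ^ 2 + x 1 ^ 2) ^ 2)) 0 := by
    have := (((hl v 0).fun_pow 2).fun_add ((hl v 1).fun_pow 2)).fun_inv (by simpa using hq)
    simpa using this.const_mul (4 * R ^ 2)
  have h1 (v : Fin 2 → ℝ) (k : Fin 2) : HasDerivAt (fun t : ℝ => f (x + t • v) k)
      (fderiv ℝ f x v k) 0 :=
    (ContinuousLinearMap.proj (R := ℝ) (φ := fun _ : Fin 2 => ℝ) k).hasFDerivAt.comp_hasDerivAt 0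
      (hd.hasFDerivAt.hasLineDerivAt v)
  have e0 (v : Fin 2 → ℝ) := (h1 v 0).unique ((hD v).fun_mul (hl v 0))
  have e1 (v : Fin 2 → ℝ) := (h1 v 1).unique ((hD v).fun_mul (hl v 1).fun_neg)
  have : (jacobian f x).det = 16 * R ^ 4 / (x 0 ^ 2 + x 1 ^ 2) ^ 2 := by
    simp only [Matrix.det_fin_two, jacobian, Matrix.of_apply, e0, e1]
    simp
    field_simp
    ring
  rw [this]
  positivity

/-- The round sphere of radius `R` with the metric induced by `ℝ³`, in the two stereographic
charts. -/
def roundSphere {R : ℝ} (hR : 0 < R) : RiemannianSurface (Sphere R) where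
  ι := ℤˣ
  chart := stereoChart hR
  metric ε := firstFundamentalForm (stereoInv R ε)
  cover p := by
    by_contra! h
    have h1 : R - p.1 2 = 0 := by simpa [stereoChart] using h 1
    have h2 : R + p.1 2 = 0 := by simpa [stereoChart] using h (-1)
    linarith
  contDiffOn_transition i j x hx := by
    have hx' : R - (j : ℤ) * stereoInv R i x 2 ≠ 0 := hx.2
    exact ((contDiffAt_stereoFun j hx').comp x
      (contDiff_stereoInv hR i).contDiffAt).contDiffWithinAt
  oriented i j x hx := by
    have hU := ((stereoChart hR i).symm.trans (stereoChart hR j)).open_source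
    rcases eq_or_ne j i with rfl | hne
    · have hid : Set.EqOn (stereoChart hR j ∘ (stereoChart hR j).symm) id
          ((stereoChart hR j).symm.trans (stereoChart hR j)).source :=
        fun y _ => stereoFun_stereoInv hR j y
      rw [RiemannianSurface.jacobian_of_eqOn_id hU hid hx]
      simp
    · obtain rfl : j = -i := by
        rcases Int.units_eq_one_or i with rfl | rfl <;>
          rcases Int.units_eq_one_or j with rfl | rfl <;> simp_all
      have hev : (stereoChart hR (-i) ∘ (stereoChart hR i).symm) =ᶠ[nhds x]
          fun x : Fin 2 → ℝ => (4 * R ^ 2 / (x 0 ^ 2 + x 1 ^ 2)) • (![x 0, -x 1] : Fin 2 → ℝ) :=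
        Filter.eventuallyEq_of_mem (hU.mem_nhds hx)
          fun y hy => (stereo_transition_neg hR i y hy.2).2
      have hjac : jacobian (stereoChart hR (-i) ∘ (stereoChart hR i).symm) x =
          jacobian (fun x : Fin 2 → ℝ =>
            (4 * R ^ 2 / (x 0 ^ 2 + x 1 ^ 2)) • (![x 0, -x 1] : Fin 2 → ℝ)) x := by
        simp only [jacobian, hev.fderiv_eq]
      rw [hjac]
      exact jacobian_inversion_det hR (stereo_transition_neg hR i x hx.2).1
  contDiffOn_metric i a b := by
    simp only [firstFundamentalForm_stereoInv hR]
    have : ContDiff ℝ ∞ (conformalFactor (1 / R ^ 2)) := by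
      unfold conformalFactor
      exact ContDiff.div contDiff_const (by fun_prop) fun x => by positivity
    exact (this.mul contDiff_const).contDiffOn
  posDef_metric i x _ := by
    rw [firstFundamentalForm_stereoInv hR]
    exact Matrix.PosDef.one.smul (by unfold conformalFactor; positivity)
  metric_transition i j x hx := by
    have hU := ((stereoChart hR i).symm.trans (stereoChart hR j)).open_source
    have hx' : R - (j : ℤ) * stereoInv R i x 2 ≠ 0 := hx.2
    have hf : DifferentiableAt ℝ (stereoFun R j ∘ stereoInv R i) x :=
      ((contDiffAt_stereoFun j hx').comp x
        (contDiff_stereoInv hR i).contDiffAt).differentiableAt (by simp)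
    have hφ : DifferentiableAt ℝ (stereoInv R j) ((stereoFun R j ∘ stereoInv R i) x) :=
      (contDiff_stereoInv hR j).differentiable (by simp) _
    have hev : stereoInv R i =ᶠ[nhds x] stereoInv R j ∘ (stereoFun R j ∘ stereoInv R i) :=
      Filter.eventuallyEq_of_mem (hU.mem_nhds hx) fun y hy =>
        (stereoInv_stereoFun hR j ⟨stereoInv R i y, stereoInv_mem hR i y⟩ hy.2).symm
    have : firstFundamentalForm (stereoInv R i) x =
        firstFundamentalForm (stereoInv R j ∘ (stereoFun R j ∘ stereoInv R i)) x := by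
      simp only [firstFundamentalForm, hev.fderiv_eq]
    rw [this]
    exact firstFundamentalForm_comp hφ hf

/-- The points `γ s`, `s ∈ I`, of the sphere lie on a circle: they have a constant positive distance
to some point of the sphere. -/
def LiesOnCircle {R : ℝ} (γ : ℝ → Sphere R) (I : Set ℝ) : Prop :=
  ∃ (p : Sphere R) (r : ℝ), 0 < r ∧ ∀ s ∈ I, dist (γ s) p = r

end

end Triharmonic

/-! All three space forms are covered by charts in which the metric is `(dx² + dy²) / w²` with `w =
1 + ρ|x|²/4` (stereographic charts in the case of the sphere), so the local analysis is done once,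
for arbitrary `ρ`. In the frame `T, JT`, with `κ` the geodesic curvature, the triharmonic equation
splits (`tension3_eq`) into a tangential part `κκ''' + 2κ'κ'' = 2κ³κ'` and a normal part `κ'''' -
15κκ'² - 10κ²κ'' + κ⁵ + ρ(κ'' - 2κ³) = 0`.

The crux is that these force `κ` to be locally constant. The tangential part has the first integral
`2κκ'' + κ'² - κ⁴ = c`; multiplied by `κ'`, this integrates to `κκ'² - κ⁵/5 - cκ = d`. Eliminating
all derivatives from the normal part leaves a polynomial equation for `κ` (`curvature_polynomial`)
whose leading coefficient is a nonzero number whatever `c`, `d`, `ρ` are. A continuous function with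
values in the finite root set is constant on an interval. The normal part then reads `κ³(κ² - 2ρ) =
0`, so `κ = 0` or `κ² = 2ρ`; for `ρ ≤ 0` both give a geodesic.

On the sphere two global points remain. The alternative must be the same along the whole curve: `κ²
= |γ''|² - ρ`, computed in `ℝ³`, is independent of the chart and continuous. And `κ² = 2ρ` must give
a circle: then `γ'' + 3ργ` is a constant nonzero vector `b` with `⟨γ, b⟩ = 2`, so `γ` lies in a
plane. -/

namespace Triharmonic

/-! ### Connection, curvature and rotation of the conformal metric -/

/-- The metric of constant curvature `ρ` in conformal coordinates. -/
noncomputable def confMetric (ρ : ℝ) (x : Fin 2 → ℝ) : Matrix (Fin 2) (Fin 2) ℝ :=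
  conformalFactor ρ x • 1

/-- The denominator `1 + ρ |x|² / 4` of the conformal metric. -/
noncomputable def confDenom (ρ : ℝ) (x : Fin 2 → ℝ) : ℝ := 1 + ρ / 4 * (x 0 ^ 2 + x 1 ^ 2)

lemma conformalFactor_eq (ρ : ℝ) (x : Fin 2 → ℝ) :
    conformalFactor ρ x = 1 / confDenom ρ x ^ 2 := rfl

lemma confMetric_apply (ρ : ℝ) (x : Fin 2 → ℝ) (i j : Fin 2) :
    confMetric ρ x i j = 1 / confDenom ρ x ^ 2 * (1 : Matrix (Fin 2) (Fin 2) ℝ) i j := rfl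

lemma hasFDerivAt_confDenom (ρ : ℝ) (x : Fin 2 → ℝ) :
    HasFDerivAt (confDenom ρ)
      ((ρ / 2 * x 0) • ContinuousLinearMap.proj (R := ℝ) (φ := fun _ : Fin 2 => ℝ) 0
        + (ρ / 2 * x 1) • ContinuousLinearMap.proj (R := ℝ) (φ := fun _ : Fin 2 => ℝ) 1) x := by
  have h (i : Fin 2) := (ContinuousLinearMap.proj (R := ℝ) (φ := fun _ : Fin 2 => ℝ) i).hasFDerivAt
    (x := x)
  have := ((((h 0).pow 2).add ((h 1).pow 2)).const_mul (ρ / 4)).const_add 1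
  refine this.congr_fderiv ?_
  ext v
  simp
  ring

lemma pderiv_eq_of_hasFDerivAt {f : (Fin 2 → ℝ) → ℝ} {f' : (Fin 2 → ℝ) →L[ℝ] ℝ} {x : Fin 2 → ℝ}
    (h : HasFDerivAt f f' x) (i : Fin 2) : pderiv i f x = f' (Pi.single i 1) := by
  rw [pderiv, h.fderiv]

lemma hasFDerivAt_conformalFactor {ρ : ℝ} {x : Fin 2 → ℝ} (hx : confDenom ρ x ≠ 0) (a : ℝ) :
    HasFDerivAt (fun y => 1 / confDenom ρ y ^ 2 * a)
      ((-(ρ * a / confDenom ρ x ^ 3)) •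
        (x 0 • ContinuousLinearMap.proj (R := ℝ) (φ := fun _ : Fin 2 => ℝ) 0
        + x 1 • ContinuousLinearMap.proj (R := ℝ) (φ := fun _ : Fin 2 => ℝ) 1)) x := by
  have h1 : HasDerivAt (fun t : ℝ => 1 / t ^ 2 * a) (-(2 * a / confDenom ρ x ^ 3))
      (confDenom ρ x) := by
    simp only [one_div]
    refine (((hasDerivAt_pow 2 (confDenom ρ x)).fun_inv
      (pow_ne_zero 2 hx)).mul_const a).congr_deriv ?_
    simp
    field_simp
  have := h1.comp_hasFDerivAt x (hasFDerivAt_confDenom ρ x)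
  refine this.congr_fderiv ?_
  ext v
  simp
  field_simp

lemma confMetric_inv {ρ : ℝ} {x : Fin 2 → ℝ} (hx : confDenom ρ x ≠ 0) (i j : Fin 2) :
    (confMetric ρ x)⁻¹ i j = confDenom ρ x ^ 2 * (1 : Matrix (Fin 2) (Fin 2) ℝ) i j := by
  have : (confMetric ρ x)⁻¹ = confDenom ρ x ^ 2 • 1 := by
    refine Matrix.inv_eq_right_inv ?_
    simp only [confMetric, conformalFactor_eq, Matrix.mul_smul, mul_one,
      smul_smul]
    rw [mul_one_div_cancel (pow_ne_zero 2 hx), one_smul]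
  rw [this]
  rfl

/-- For a metric `e^{2f} δ` the symbols are `δⱼₖ ∂ᵢf + δᵢₖ ∂ⱼf - δᵢⱼ ∂ₖf`; here `f = -log w`, so
`∂ᵢf = -ρ xᵢ / (2w)`. -/
lemma christoffel_confMetric {ρ : ℝ} {x : Fin 2 → ℝ} (hx : confDenom ρ x ≠ 0) (k i j : Fin 2) :
    christoffel (confMetric ρ) k i j x =
      -(ρ / (2 * confDenom ρ x)) * ((1 : Matrix (Fin 2) (Fin 2) ℝ) j k * x i
        + (1 : Matrix (Fin 2) (Fin 2) ℝ) i k * x j - (1 : Matrix (Fin 2) (Fin 2) ℝ) i j * x k) := by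
  have h (i : Fin 2) (a : ℝ) := pderiv_eq_of_hasFDerivAt (hasFDerivAt_conformalFactor hx a) i
  simp only [christoffel, confMetric_apply, confMetric_inv hx, h]
  have h2 : ∀ a : Fin 2, a = 0 ∨ a = 1 := by decide
  rcases h2 k with rfl | rfl <;> rcases h2 i with rfl | rfl <;> rcases h2 j with rfl | rfl <;>
    simp <;> field_simp

lemma pderiv_christoffel_confMetric {ρ : ℝ} {x : Fin 2 → ℝ} (hx : confDenom ρ x ≠ 0)
    (l k i j : Fin 2) :
    pderiv l (christoffel (confMetric ρ) k i j) x =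
      ρ ^ 2 * x l / (4 * confDenom ρ x ^ 2) * ((1 : Matrix (Fin 2) (Fin 2) ℝ) j k * x i
        + (1 : Matrix (Fin 2) (Fin 2) ℝ) i k * x j - (1 : Matrix (Fin 2) (Fin 2) ℝ) i j * x k)
      - ρ / (2 * confDenom ρ x) * ((1 : Matrix (Fin 2) (Fin 2) ℝ) j k *
          (1 : Matrix (Fin 2) (Fin 2) ℝ) i l
        + (1 : Matrix (Fin 2) (Fin 2) ℝ) i k * (1 : Matrix (Fin 2) (Fin 2) ℝ) j l
        - (1 : Matrix (Fin 2) (Fin 2) ℝ) i j * (1 : Matrix (Fin 2) (Fin 2) ℝ) k l) := by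
  have hev : ∀ᶠ y in nhds x, confDenom ρ y ≠ 0 :=
    (hasFDerivAt_confDenom ρ x).continuousAt.eventually_ne hx
  have hev' : christoffel (confMetric ρ) k i j =ᶠ[nhds x] fun y =>
      -(ρ / (2 * confDenom ρ y)) * ((1 : Matrix (Fin 2) (Fin 2) ℝ) j k * y i
        + (1 : Matrix (Fin 2) (Fin 2) ℝ) i k * y j
        - (1 : Matrix (Fin 2) (Fin 2) ℝ) i j * y k) :=
    hev.mono fun y hy => christoffel_confMetric hy k i j
  have h1 : HasDerivAt (fun t : ℝ => -(ρ / (2 * t))) (ρ / (2 * confDenom ρ x ^ 2))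
      (confDenom ρ x) := by
    have he : (fun t : ℝ => -(ρ / (2 * t))) = fun t => -(ρ / 2) * t⁻¹ := by
      ext t
      rw [div_mul_eq_div_div, div_eq_mul_inv (ρ / 2) t, neg_mul]
    rw [he]
    refine ((hasDerivAt_inv hx).const_mul (-(ρ / 2))).congr_deriv ?_
    field_simp
  have h2 := h1.comp_hasFDerivAt x (hasFDerivAt_confDenom ρ x)
  have hp (i : Fin 2) := (ContinuousLinearMap.proj (R := ℝ) (φ := fun _ : Fin 2 => ℝ)
    i).hasFDerivAt (x := x)
  have h3 := h2.mul ((((hp i).const_mul ((1 : Matrix (Fin 2) (Fin 2) ℝ) j k)).add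
    ((hp j).const_mul ((1 : Matrix (Fin 2) (Fin 2) ℝ) i k))).sub
    ((hp k).const_mul ((1 : Matrix (Fin 2) (Fin 2) ℝ) i j)))
  rw [pderiv, hev'.fderiv_eq]
  have h4 := pderiv_eq_of_hasFDerivAt h3 l
  refine Eq.trans h4 ?_
  have h2 : ∀ a : Fin 2, a = 0 ∨ a = 1 := by decide
  rcases h2 l with rfl | rfl <;> rcases h2 k with rfl | rfl <;> rcases h2 i with rfl | rfl <;>
    rcases h2 j with rfl | rfl <;> simp <;> field_simp <;> ring

/-- This identifies the parameter `ρ` as the sectional curvature and reduces the curvature terms of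
the tension field to scalar products. -/
lemma riemann_confMetric {ρ : ℝ} {x : Fin 2 → ℝ} (hx : confDenom ρ x ≠ 0) (X Y Z : Fin 2 → ℝ) :
    riemann (confMetric ρ) x X Y Z =
      ρ • (scal (confMetric ρ) x Y Z • X - scal (confMetric ρ) x X Z • Y) := by
  ext l
  -- The only relation between `x` and the denominator `w` that is needed; after it is recorded, `w`
  -- can be treated as an independent variable.
  have hw : x 0 ^ 2 * ρ + x 1 ^ 2 * ρ = 4 * confDenom ρ x - 4 := by
    simp only [confDenom]; ring
  simp only [riemann, riemannComp, pderiv_christoffel_confMetric hx, christoffel_confMetric hx,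
    scal, confMetric_apply, Fin.sum_univ_two]
  generalize confDenom ρ x = w at hx hw
  have h2 : ∀ a : Fin 2, a = 0 ∨ a = 1 := by decide
  rcases h2 l with rfl | rfl <;> simp <;> field_simp
  · linear_combination -(4 * ρ * (X 0 * Y 1 * Z 1 - Z 1 * X 1 * Y 0)) * hw
  · linear_combination -(4 * ρ * (X 1 * Y 0 * Z 0 - Z 0 * X 0 * Y 1)) * hw

/-- The counter-clockwise quarter turn of `ℝ²`. -/
def quarterTurn (v : Fin 2 → ℝ) : Fin 2 → ℝ := ![-v 1, v 0]

@[simp] lemma quarterTurn_zero (v : Fin 2 → ℝ) : quarterTurn v 0 = -v 1 := rfl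

@[simp] lemma quarterTurn_one (v : Fin 2 → ℝ) : quarterTurn v 1 = v 0 := rfl

lemma scal_confMetric (ρ : ℝ) (x v u : Fin 2 → ℝ) :
    scal (confMetric ρ) x v u = (v 0 * u 0 + v 1 * u 1) / confDenom ρ x ^ 2 := by
  simp [scal, confMetric_apply]
  ring

/-- A conformal metric has the Euclidean angles, so the factor `w` cancels. -/
lemma rotJ_confMetric {ρ : ℝ} {x : Fin 2 → ℝ} (hx : confDenom ρ x ≠ 0) (v : Fin 2 → ℝ) :
    rotJ (confMetric ρ) x v = quarterTurn v := by
  have h : √(confMetric ρ x).det = 1 / confDenom ρ x ^ 2 := by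
    rw [show (confMetric ρ x).det = (1 / confDenom ρ x ^ 2) ^ 2 by
      simp [Matrix.det_fin_two, confMetric_apply]; ring]
    exact Real.sqrt_sq (by positivity)
  ext k
  rw [rotJ, h]
  fin_cases k <;> simp [confMetric_apply] <;> field_simp

lemma covDeriv_confMetric {ρ : ℝ} {c : ℝ → Fin 2 → ℝ} {s : ℝ} (hx : confDenom ρ (c s) ≠ 0)
    (V : ℝ → Fin 2 → ℝ) (k : Fin 2) :
    covDeriv (confMetric ρ) c V s k = deriv V s k - ρ / (2 * confDenom ρ (c s)) *
      ((c s 0 * deriv c s 0 + c s 1 * deriv c s 1) * V s k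
        + (c s 0 * V s 0 + c s 1 * V s 1) * deriv c s k
        - (deriv c s 0 * V s 0 + deriv c s 1 * V s 1) * c s k) := by
  have h2 : ∀ a : Fin 2, a = 0 ∨ a = 1 := by decide
  simp only [covDeriv, christoffel_confMetric hx, Fin.sum_univ_two]
  rcases h2 k with rfl | rfl <;> simp <;> ring

lemma hasDerivAt_quarterTurn {V : ℝ → Fin 2 → ℝ} {V' : Fin 2 → ℝ} {s : ℝ}
    (hV : HasDerivAt V V' s) :
    HasDerivAt (fun t => quarterTurn (V t)) (quarterTurn V') s := by
  rw [hasDerivAt_pi] at hV ⊢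
  intro i
  fin_cases i
  · exact (hV 1).neg
  · exact hV 0

/-- `J` is parallel: in complex notation the connection term is multiplication of `V` by `-ρ c̄ c' /
(2w)`, which commutes with multiplication by `i`. -/
lemma covDeriv_quarterTurn {ρ : ℝ} {c : ℝ → Fin 2 → ℝ} {s : ℝ} (hx : confDenom ρ (c s) ≠ 0)
    {V : ℝ → Fin 2 → ℝ} (hV : DifferentiableAt ℝ V s) :
    covDeriv (confMetric ρ) c (fun t => quarterTurn (V t)) s =
      quarterTurn (covDeriv (confMetric ρ) c V s) := by
  ext k
  have h2 : ∀ a : Fin 2, a = 0 ∨ a = 1 := by decide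
  rcases h2 k with rfl | rfl <;>
    simp only [quarterTurn_zero, quarterTurn_one, covDeriv_confMetric hx,
      (hasDerivAt_quarterTurn hV.hasDerivAt).deriv] <;> ring

lemma covDeriv_smul_add_smul {n : ℕ} (g : (Fin n → ℝ) → Matrix (Fin n) (Fin n) ℝ)
    (c : ℝ → Fin n → ℝ) {V W : ℝ → Fin n → ℝ} {a b : ℝ → ℝ} {a' b' s : ℝ}
    (hV : DifferentiableAt ℝ V s) (hW : DifferentiableAt ℝ W s)
    (ha : HasDerivAt a a' s) (hb : HasDerivAt b b' s) :
    covDeriv g c (fun t => a t • V t + b t • W t) s =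
      a' • V s + a s • covDeriv g c V s + b' • W s + b s • covDeriv g c W s := by
  ext k
  have h := ((ha.fun_smul hV.hasDerivAt).fun_add (hb.fun_smul hW.hasDerivAt)).deriv
  simp only [covDeriv, h, Pi.add_apply, Pi.smul_apply, smul_eq_mul, mul_add,
    Finset.mul_sum, Finset.sum_add_distrib]
  have e1 : ∀ i j, christoffel g k i j (c s) * deriv c s i * (a s * V s j) =
      a s * (christoffel g k i j (c s) * deriv c s i * V s j) := fun _ _ => by ring
  have e2 : ∀ i j, christoffel g k i j (c s) * deriv c s i * (b s * W s j) =
      b s * (christoffel g k i j (c s) * deriv c s i * W s j) := fun _ _ => by ring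
  simp only [e1, e2]
  ring

lemma covDeriv_congr {n : ℕ} (g : (Fin n → ℝ) → Matrix (Fin n) (Fin n) ℝ)
    (c : ℝ → Fin n → ℝ) {V W : ℝ → Fin n → ℝ} {U : Set ℝ} (hU : IsOpen U)
    (h : Set.EqOn V W U) : Set.EqOn (covDeriv g c V) (covDeriv g c W) U := by
  intro s hs
  have he := h.eventuallyEq_of_mem (hU.mem_nhds hs)
  ext k
  simp only [covDeriv, he.deriv_eq, h hs]

/-! ### Unit speed curves in a conformal chart and their Frenet equations -/

/-- A smooth unit speed curve, defined on an open set of parameters, in conformal coordinates of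
the surface of constant curvature `ρ`. -/
structure IsConfCurve (ρ : ℝ) (c : ℝ → Fin 2 → ℝ) (U : Set ℝ) : Prop where
  isOpen : IsOpen U
  smooth : ContDiffOn ℝ ∞ c U
  pos : ∀ s ∈ U, 0 < confDenom ρ (c s)
  unit_speed : ∀ s ∈ U, scal (confMetric ρ) (c s) (deriv c s) (deriv c s) = 1

lemma contDiffOn_iterate_deriv {E : Type*} [NormedAddCommGroup E] [NormedSpace ℝ E] {f : ℝ → E}
    {U : Set ℝ} (hU : IsOpen U) (hf : ContDiffOn ℝ ∞ f U) (m : ℕ) :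
    ContDiffOn ℝ ∞ (deriv^[m] f) U := by
  induction m with
  | zero => exact hf
  | succ m ih =>
    rw [Function.iterate_succ_apply']
    exact ih.deriv_of_isOpen hU (by simp)

lemma hasDerivAt_iterate_deriv {E : Type*} [NormedAddCommGroup E] [NormedSpace ℝ E] {f : ℝ → E}
    {U : Set ℝ} (hU : IsOpen U) (hf : ContDiffOn ℝ ∞ f U) (m : ℕ) {s : ℝ} (hs : s ∈ U) :
    HasDerivAt (deriv^[m] f) (deriv^[m + 1] f s) s := by
  rw [Function.iterate_succ_apply']
  exact (((contDiffOn_iterate_deriv hU hf m).contDiffAt (hU.mem_nhds hs)).differentiableAt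
    (by simp)).hasDerivAt

namespace IsConfCurve

variable {ρ : ℝ} {c : ℝ → Fin 2 → ℝ} {U : Set ℝ}

lemma speed_sq (h : IsConfCurve ρ c U) {s : ℝ} (hs : s ∈ U) :
    deriv c s 0 ^ 2 + deriv c s 1 ^ 2 = confDenom ρ (c s) ^ 2 := by
  have h1 := h.unit_speed s hs
  have h0 := (h.pos s hs).ne'
  rw [scal_confMetric, div_eq_one_iff_eq (pow_ne_zero 2 h0)] at h1
  rw [← h1]; ring

lemma hasDerivAt (h : IsConfCurve ρ c U) {s : ℝ} (hs : s ∈ U) (i : Fin 2) :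
    HasDerivAt (fun t => c t i) (deriv c s i) s :=
  hasDerivAt_pi.1 (hasDerivAt_iterate_deriv h.isOpen h.smooth 0 hs) i

lemma hasDerivAt_deriv (h : IsConfCurve ρ c U) {s : ℝ} (hs : s ∈ U) :
    HasDerivAt (deriv c) (deriv (deriv c) s) s :=
  hasDerivAt_iterate_deriv h.isOpen h.smooth 1 hs

/-- Half the derivative of the unit speed condition `|c'|² = w²`. -/
lemma inner_deriv (h : IsConfCurve ρ c U) {s : ℝ} (hs : s ∈ U) :
    deriv c s 0 * deriv (deriv c) s 0 + deriv c s 1 * deriv (deriv c) s 1 =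
      confDenom ρ (c s) * (ρ / 2) * (c s 0 * deriv c s 0 + c s 1 * deriv c s 1) := by
  have hT (i : Fin 2) := hasDerivAt_pi.1 (h.hasDerivAt_deriv hs) i
  have hc := h.hasDerivAt hs
  have h1 := ((hT 0).fun_pow 2).fun_add ((hT 1).fun_pow 2)
  have h2 := ((((((hc 0).fun_pow 2).fun_add ((hc 1).fun_pow 2)).const_mul (ρ / 4)).const_add
    1).fun_pow 2)
  have he : (fun t => deriv c t 0 ^ 2 + deriv c t 1 ^ 2) =ᶠ[nhds s]
      fun t => (1 + ρ / 4 * (c t 0 ^ 2 + c t 1 ^ 2)) ^ 2 :=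
    Filter.eventuallyEq_of_mem (h.isOpen.mem_nhds hs) fun t ht => h.speed_sq ht
  have h3 := h1.unique (h2.congr_of_eventuallyEq he)
  simp only [confDenom]
  simp at h3
  linear_combination h3 / 2

lemma geodCurv_eq (h : IsConfCurve ρ c U) {s : ℝ} (hs : s ∈ U) :
    geodCurv (confMetric ρ) c s =
      (deriv c s 0 * covIter (confMetric ρ) c 1 s 1 - deriv c s 1 * covIter (confMetric ρ) c 1 s 0)
        / confDenom ρ (c s) ^ 2 := by
  rw [geodCurv, rotJ_confMetric (h.pos s hs).ne', scal_confMetric]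
  simp only [covIter, Function.iterate_zero, id, quarterTurn_zero, quarterTurn_one]
  ring

lemma covIter_one_apply (h : IsConfCurve ρ c U) {s : ℝ} (hs : s ∈ U) (k : Fin 2) :
    covIter (confMetric ρ) c 1 s k = deriv (deriv c) s k - ρ / (2 * confDenom ρ (c s)) *
      (2 * (c s 0 * deriv c s 0 + c s 1 * deriv c s 1) * deriv c s k
        - confDenom ρ (c s) ^ 2 * c s k) := by
  have := covDeriv_confMetric (h.pos s hs).ne' (deriv c) k
  simp only [covIter, Function.iterate_one, this, ← h.speed_sq hs]
  ring

/-- Unit speed makes `∇_T T` orthogonal to `T`, and in dimension two only the `JT` component is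
left. -/
lemma covIter_one (h : IsConfCurve ρ c U) {s : ℝ} (hs : s ∈ U) :
    covIter (confMetric ρ) c 1 s = geodCurv (confMetric ρ) c s • quarterTurn (deriv c s) := by
  have h0 := (h.pos s hs).ne'
  have e := h.inner_deriv hs
  have e1 := h.speed_sq hs
  have horth : covIter (confMetric ρ) c 1 s 0 * deriv c s 0
      + covIter (confMetric ρ) c 1 s 1 * deriv c s 1 = 0 := by
    simp only [h.covIter_one_apply hs]
    field_simp
    linear_combination 2 * confDenom ρ (c s) * e - 2 * (c s 0 * deriv c s 0 + c s 1 * deriv c s 1) * ρ * e1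
  rw [h.geodCurv_eq hs]
  ext k
  fin_cases k <;> simp <;> field_simp <;> rw [← e1]
  · linear_combination deriv c s 0 * horth
  · linear_combination deriv c s 1 * horth

lemma contDiffOn_geodCurv (h : IsConfCurve ρ c U) :
    ContDiffOn ℝ ∞ (geodCurv (confMetric ρ) c) U := by
  have hc := contDiffOn_pi.1 h.smooth
  have hT := contDiffOn_pi.1 (contDiffOn_iterate_deriv h.isOpen h.smooth 1)
  have hA := contDiffOn_pi.1 (contDiffOn_iterate_deriv h.isOpen h.smooth 2)
  have hw : ContDiffOn ℝ ∞ (fun s => confDenom ρ (c s)) U :=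
    contDiffOn_const.add (contDiffOn_const.mul (((hc 0).pow 2).add ((hc 1).pow 2)))
  have hcov (k : Fin 2) : ContDiffOn ℝ ∞ (fun s => covIter (confMetric ρ) c 1 s k) U := by
    refine ContDiffOn.congr ?_ fun s hs => h.covIter_one_apply hs k
    refine (hA k).sub ((contDiffOn_const.div (contDiffOn_const.mul hw) fun s hs => ?_).mul
      (((contDiffOn_const.mul (((hc 0).mul (hT 0)).add ((hc 1).mul (hT 1)))).mul (hT k)).sub
        ((hw.pow 2).mul (hc k))))
    exact mul_ne_zero two_ne_zero (h.pos s hs).ne'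
  refine ContDiffOn.congr ?_ fun s hs => h.geodCurv_eq hs
  exact (((hT 0).mul (hcov 1)).sub ((hT 1).mul (hcov 0))).div (hw.pow 2)
    fun s hs => pow_ne_zero 2 (h.pos s hs).ne'

/-- The Frenet equations. -/
lemma covDeriv_frame (h : IsConfCurve ρ c U) {s : ℝ} (hs : s ∈ U) {a b : ℝ → ℝ} {a' b' : ℝ}
    (ha : HasDerivAt a a' s) (hb : HasDerivAt b b' s) :
    covDeriv (confMetric ρ) c (fun t => a t • deriv c t + b t • quarterTurn (deriv c t)) s =
      (a' - geodCurv (confMetric ρ) c s * b s) • deriv c s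
        + (b' + geodCurv (confMetric ρ) c s * a s) • quarterTurn (deriv c s) := by
  have hT := (h.hasDerivAt_deriv hs)
  have h1 : covDeriv (confMetric ρ) c (deriv c) s =
    geodCurv (confMetric ρ) c s • quarterTurn (deriv c s) := h.covIter_one hs
  rw [covDeriv_smul_add_smul _ _ hT.differentiableAt
    (hasDerivAt_quarterTurn hT).differentiableAt ha hb,
    covDeriv_quarterTurn (h.pos s hs).ne' hT.differentiableAt, h1]
  ext k
  fin_cases k <;> simp <;> ring

/-- The recursion `(a, b) ↦ (a' - κb, b' + κa)` for the frame coefficients of `∇_Tᵐ T`. The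
expansion is required on all of the open set `U`, since it gets differentiated. -/
lemma covIter_succ (h : IsConfCurve ρ c U) {m : ℕ} {a b a' b' : ℝ → ℝ}
    (hm : ∀ s ∈ U, covIter (confMetric ρ) c m s =
      a s • deriv c s + b s • quarterTurn (deriv c s))
    (ha : ∀ s ∈ U, HasDerivAt a (a' s) s) (hb : ∀ s ∈ U, HasDerivAt b (b' s) s) :
    ∀ s ∈ U, covIter (confMetric ρ) c (m + 1) s =
      (a' s - geodCurv (confMetric ρ) c s * b s) • deriv c s
        + (b' s + geodCurv (confMetric ρ) c s * a s) • quarterTurn (deriv c s) := by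
  intro s hs
  rw [← h.covDeriv_frame hs (ha s hs) (hb s hs), covIter, Function.iterate_succ_apply']
  exact covDeriv_congr _ _ h.isOpen hm hs

end IsConfCurve

/-! ### The differential equations for the curvature force it to be locally constant -/

lemma eqOn_iterate_deriv_zero {f : ℝ → ℝ} {U : Set ℝ} (hU : IsOpen U) (hf : Set.EqOn f 0 U)
    (m : ℕ) : Set.EqOn (deriv^[m] f) 0 U := by
  induction m with
  | zero => exact hf
  | succ m ih =>
    intro s hs
    rw [Function.iterate_succ_apply', (ih.eventuallyEq_of_mem (hU.mem_nhds hs)).deriv_eq]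
    simp

/-- Differentiating gives `2κκ' = 0`; if `a ≠ 0` one divides by `κ`, and if `a = 0` then `κ` itself
vanishes. -/
lemma deriv_eq_zero_of_sq_eq {κ : ℝ → ℝ} {U : Set ℝ} (hU : IsOpen U) (hκ : ContDiffOn ℝ ∞ κ U)
    {a : ℝ} (ha : ∀ s ∈ U, κ s ^ 2 = a) : Set.EqOn (deriv κ) 0 U := by
  by_cases h0 : a = 0
  · exact eqOn_iterate_deriv_zero hU (fun t ht => by simpa [h0] using ha t ht) 1
  · intro t ht
    have h1 := (hasDerivAt_iterate_deriv hU hκ 0 ht).fun_pow 2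
    have he : (fun t => κ t ^ 2) =ᶠ[nhds t] fun _ => a :=
      Filter.eventuallyEq_of_mem (hU.mem_nhds ht) ha
    have h2 := h1.unique ((hasDerivAt_const t a).congr_of_eventuallyEq he)
    have h3 : κ t ≠ 0 := fun h3 => h0 (by rw [← ha t ht, h3]; simp)
    simpa [h3] using h2

/-- A continuous function on a preconnected set whose values are roots of a nonzero polynomial is
constant. -/
lemma eqOn_const_of_eval_eq_zero {α : Type*} [TopologicalSpace α] {f : α → ℝ} {S : Set α}
    (hS : IsPreconnected S) (hf : ContinuousOn f S) {p : Polynomial ℝ} (hp : p ≠ 0)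
    (h : ∀ t ∈ S, p.eval (f t) = 0) {s : α} (hs : s ∈ S) : ∀ t ∈ S, f t = f s := by
  have hfin : (p.roots.toFinset : Set ℝ).Finite := p.roots.toFinset.finite_toSet
  have := hfin.isDiscrete
  have hm : Set.MapsTo f S (p.roots.toFinset : Set ℝ) := fun t ht => by
    simpa [hp] using h t ht
  intro t ht
  exact hS.constant_of_mapsTo this hf hm ht hs

/-- The tangential part of the triharmonic equation has two first integrals; together with the
normal part they force the curvature to be a root of a fixed polynomial. -/
lemma curvature_polynomial {c d ρ u q r k₃ k₄ : ℝ}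
    (h₁ : u * q ^ 2 = u ^ 5 / 5 + c * u + d) (h₂ : 2 * u * r + q ^ 2 - u ^ 4 = c)
    (h₃ : u * k₃ = 2 * u ^ 3 * q - 2 * q * r)
    (h₄ : u * k₄ + 3 * q * k₃ + 2 * r ^ 2 = 6 * u ^ 2 * q ^ 2 + 2 * u ^ 3 * r)
    (h₅ : k₄ - 15 * u * q ^ 2 - 10 * u ^ 2 * r + u ^ 5 + ρ * (r - 2 * u ^ 3) = 0) :
    -126 / 25 * u ^ 10 - 8 * ρ / 5 * u ^ 8 - 63 * c / 5 * u ^ 6 - 42 * d / 5 * u ^ 5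
      - ρ * d / 2 * u ^ 3 - 3 * c * d * u - 7 / 2 * d ^ 2 = 0 := by
  -- Here `u, q, r, k₃, k₄` stand for `κ` and its first four derivatives. Each derivative is
  -- eliminated after multiplication by a power of `u`, never by division, so zeros of `κ` need no
  -- separate treatment.
  have hr : u ^ 2 * r = (4 / 5 * u ^ 5 - d) / 2 := by linear_combination u / 2 * h₂ - h₁ / 2
  have hk₃ : u ^ 4 * q * k₃ = (u ^ 5 / 5 + c * u + d) * (2 * u ^ 5 - (4 / 5 * u ^ 5 - d)) := by
    linear_combination u ^ 3 * q * h₃ + (2 * u ^ 5 - 2 * u ^ 2 * r) * h₁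
      - 2 * (u ^ 5 / 5 + c * u + d) * hr
  have hk₄ : u ^ 5 * k₄ = 6 * u ^ 5 * (u ^ 5 / 5 + c * u + d) + u ^ 5 * (4 / 5 * u ^ 5 - d)
      - (4 / 5 * u ^ 5 - d) ^ 2 / 2
      - 3 * ((u ^ 5 / 5 + c * u + d) * (2 * u ^ 5 - (4 / 5 * u ^ 5 - d))) := by
    linear_combination u ^ 4 * h₄ - 3 * hk₃ + 6 * u ^ 5 * h₁ + 2 * u ^ 5 * hr
      - 2 * (u ^ 2 * r + (4 / 5 * u ^ 5 - d) / 2) * hr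
  linear_combination u ^ 5 * h₅ - hk₄ + 15 * u ^ 5 * h₁ + 10 * u ^ 5 * hr - ρ * u ^ 3 * hr

/-- Solutions of the triharmonic equations for the curvature are locally constant. -/
lemma deriv_eq_zero_of_triharmonic_ode {ρ : ℝ} {κ : ℝ → ℝ} {U : Set ℝ} (hU : IsOpen U)
    (hκ : ContDiffOn ℝ ∞ κ U)
    (htan : ∀ s ∈ U, -10 * deriv^[1] κ s * deriv^[2] κ s - 5 * κ s * deriv^[3] κ s
      + 10 * κ s ^ 3 * deriv^[1] κ s = 0)
    (hnor : ∀ s ∈ U, deriv^[4] κ s - 15 * κ s * deriv^[1] κ s ^ 2 - 10 * κ s ^ 2 * deriv^[2] κ s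
      + κ s ^ 5 + ρ * (deriv^[2] κ s - 2 * κ s ^ 3) = 0) :
    Set.EqOn (deriv κ) 0 U := by
  intro s hs
  obtain ⟨r, hr, hrU⟩ := Metric.isOpen_iff.1 hU s hs
  -- `U` may be disconnected and the constants `c`, `d` may differ between components, so the
  -- argument runs on an interval around `s`.
  set B := Metric.ball s r
  have hBo : IsOpen B := Metric.isOpen_ball
  have hB : IsPreconnected B := (convex_ball s r).isPreconnected
  have hsB : s ∈ B := Metric.mem_ball_self hr
  have hd (m : ℕ) {t : ℝ} (ht : t ∈ B) : HasDerivAt (deriv^[m] κ) (deriv^[m + 1] κ t) t :=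
    hasDerivAt_iterate_deriv hU hκ m (hrU ht)
  have hd0 {t : ℝ} (ht : t ∈ B) : HasDerivAt κ (deriv^[1] κ t) t := hd 0 ht
  have const {f : ℝ → ℝ} (hf : ∀ t ∈ B, HasDerivAt f 0 t) : ∀ t ∈ B, f t = f s := fun t ht =>
    hBo.is_const_of_deriv_eq_zero hB (fun x hx => (hf x hx).differentiableAt.differentiableWithinAt)
      (fun x hx => (hf x hx).deriv) ht hsB
  have h₂ : ∀ t ∈ B, 2 * κ t * deriv^[2] κ t + deriv^[1] κ t ^ 2 - κ t ^ 4 =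
      2 * κ s * deriv^[2] κ s + deriv^[1] κ s ^ 2 - κ s ^ 4 := by
    refine const (f := fun t => 2 * κ t * deriv^[2] κ t + deriv^[1] κ t ^ 2 - κ t ^ 4)
      fun t ht => ?_
    refine (((((hd0 ht).const_mul 2).fun_mul (hd 2 ht)).fun_add ((hd 1 ht).fun_pow 2)).fun_sub
      ((hd0 ht).fun_pow 4)).congr_deriv ?_
    have := htan t (hrU ht)
    push_cast
    linear_combination -2 / 5 * this
  set c := 2 * κ s * deriv^[2] κ s + deriv^[1] κ s ^ 2 - κ s ^ 4
  have h₁ : ∀ t ∈ B, κ t * deriv^[1] κ t ^ 2 - κ t ^ 5 / 5 - c * κ t =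
      κ s * deriv^[1] κ s ^ 2 - κ s ^ 5 / 5 - c * κ s := by
    -- The derivative of this function is `κ'` times the first integral minus `c`.
    refine const (f := fun t => κ t * deriv^[1] κ t ^ 2 - κ t ^ 5 / 5 - c * κ t) fun t ht => ?_
    refine ((((hd0 ht).fun_mul ((hd 1 ht).fun_pow 2)).fun_sub
      (((hd0 ht).fun_pow 5).div_const 5)).fun_sub ((hd0 ht).const_mul c)).congr_deriv ?_
    push_cast
    linear_combination deriv^[1] κ t * h₂ t ht
  set d := κ s * deriv^[1] κ s ^ 2 - κ s ^ 5 / 5 - c * κ s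
  have h₃ : ∀ t ∈ B, κ t * deriv^[3] κ t =
      2 * κ t ^ 3 * deriv^[1] κ t - 2 * deriv^[1] κ t * deriv^[2] κ t := fun t ht => by
    linear_combination -1 / 5 * htan t (hrU ht)
  have h₄ : ∀ t ∈ B, κ t * deriv^[4] κ t + 3 * deriv^[1] κ t * deriv^[3] κ t
      + 2 * deriv^[2] κ t ^ 2 =
      6 * κ t ^ 2 * deriv^[1] κ t ^ 2 + 2 * κ t ^ 3 * deriv^[2] κ t := fun t ht => by
    have e1 := (hd0 ht).fun_mul (hd 3 ht)
    have e2 := ((((hd0 ht).fun_pow 3).const_mul 2).fun_mul (hd 1 ht)).fun_sub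
      (((hd 1 ht).const_mul 2).fun_mul (hd 2 ht))
    have := e1.unique (e2.congr_of_eventuallyEq
      (Filter.eventuallyEq_of_mem (hBo.mem_nhds ht) h₃))
    push_cast at this
    linear_combination this
  set p : Polynomial ℝ := .C (-126 / 25) * .X ^ 10 - .C (8 * ρ / 5) * .X ^ 8
    - .C (63 * c / 5) * .X ^ 6 - .C (42 * d / 5) * .X ^ 5 - .C (ρ * d / 2) * .X ^ 3
    - .C (3 * c * d) * .X - .C (7 / 2 * d ^ 2) with hp
  -- The leading coefficient does not involve `c`, `d` or `ρ`, so no degenerate case has to be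
  -- excluded.
  have hp0 : p ≠ 0 := fun h => by
    have : p.coeff 10 = -126 / 25 := by
      simp [hp, -map_mul, -map_pow, Polynomial.coeff_X_pow]
    rw [h] at this
    norm_num at this
  have hconst : ∀ t ∈ B, κ t = κ s := by
    refine eqOn_const_of_eval_eq_zero hB (hκ.continuousOn.mono hrU) hp0 (fun t ht => ?_) hsB
    have := curvature_polynomial (d := d) (by linear_combination h₁ t ht) (h₂ t ht) (h₃ t ht) (h₄ t ht)
      (hnor t (hrU ht))
    simpa [hp] using this
  have he : κ =ᶠ[nhds s] fun _ => κ s := Filter.eventuallyEq_of_mem (hBo.mem_nhds hsB) hconst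
  simp [he.deriv_eq]

/-! ### The triharmonic equation in the Frenet frame -/

namespace IsConfCurve

variable {ρ : ℝ} {c : ℝ → Fin 2 → ℝ} {U : Set ℝ}

lemma frame_eq_zero_iff (h : IsConfCurve ρ c U) {s : ℝ} (hs : s ∈ U) {a b : ℝ} :
    a • deriv c s + b • quarterTurn (deriv c s) = 0 ↔ a = 0 ∧ b = 0 := by
  refine ⟨fun he => ?_, fun ⟨ha, hb⟩ => by simp [ha, hb]⟩
  have e0 := congrFun he 0
  have e1 := congrFun he 1
  simp at e0 e1
  have hw := h.speed_sq hs
  have h0 := pow_ne_zero 2 (h.pos s hs).ne'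
  constructor <;> refine (mul_eq_zero.1 ?_).resolve_right h0 <;> rw [← hw]
  · linear_combination deriv c s 0 * e0 + deriv c s 1 * e1
  · linear_combination deriv c s 0 * e1 - deriv c s 1 * e0

/-- The 3-tension field in the Frenet frame. -/
lemma tension3_eq (h : IsConfCurve ρ c U) {κ : ℝ → ℝ} (hκ : geodCurv (confMetric ρ) c = κ) {s : ℝ}
    (hs : s ∈ U) :
    tension3 (confMetric ρ) c s =
      (-10 * deriv^[1] κ s * deriv^[2] κ s - 5 * κ s * deriv^[3] κ s
        + 10 * κ s ^ 3 * deriv^[1] κ s) • deriv c s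
      + (deriv^[4] κ s - 15 * κ s * deriv^[1] κ s ^ 2 - 10 * κ s ^ 2 * deriv^[2] κ s
        + κ s ^ 5 + ρ * (deriv^[2] κ s - 2 * κ s ^ 3)) • quarterTurn (deriv c s) := by
  have hd (m : ℕ) {t : ℝ} (ht : t ∈ U) : HasDerivAt (deriv^[m] κ) (deriv^[m + 1] κ t) t :=
    hasDerivAt_iterate_deriv h.isOpen (hκ ▸ h.contDiffOn_geodCurv) m ht
  have hd0 {t : ℝ} (ht : t ∈ U) : HasDerivAt κ (deriv^[1] κ t) t := hd 0 ht
  have c0 : ∀ s, covIter (confMetric ρ) c 0 s = deriv c s := fun _ => rfl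
  have c1 : ∀ s ∈ U, covIter (confMetric ρ) c 1 s =
      (0 : ℝ) • deriv c s + κ s • quarterTurn (deriv c s) := fun s hs => by
    rw [h.covIter_one hs, hκ, zero_smul, zero_add]
  have c2 : ∀ s ∈ U, covIter (confMetric ρ) c 2 s =
      (-κ s ^ 2) • deriv c s + deriv^[1] κ s • quarterTurn (deriv c s) := fun s hs => by
    rw [h.covIter_succ c1 (fun t _ => hasDerivAt_const t 0) (fun t ht => hd0 ht) s hs, hκ]
    congr 2 <;> ring
  have c3 : ∀ s ∈ U, covIter (confMetric ρ) c 3 s =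
      (-3 * κ s * deriv^[1] κ s) • deriv c s
        + (deriv^[2] κ s - κ s ^ 3) • quarterTurn (deriv c s) := fun s hs => by
    rw [h.covIter_succ c2 (fun t ht => ((hd0 ht).fun_pow 2).fun_neg) (fun t ht => hd 1 ht) s hs, hκ]
    congr 2 <;> push_cast <;> ring
  have c4 : ∀ s ∈ U, covIter (confMetric ρ) c 4 s =
      (-3 * deriv^[1] κ s ^ 2 - 4 * κ s * deriv^[2] κ s + κ s ^ 4) • deriv c s
        + (deriv^[3] κ s - 6 * κ s ^ 2 * deriv^[1] κ s) • quarterTurn (deriv c s) :=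
      fun s hs => by
    rw [h.covIter_succ c3 (fun t ht => ((hd0 ht).const_mul (-3)).fun_mul (hd 1 ht))
      (fun t ht => (hd 2 ht).fun_sub ((hd0 ht).fun_pow 3)) s hs, hκ]
    congr 2 <;> push_cast <;> ring
  have c5 : ∀ s ∈ U, covIter (confMetric ρ) c 5 s =
      (-10 * deriv^[1] κ s * deriv^[2] κ s - 5 * κ s * deriv^[3] κ s
        + 10 * κ s ^ 3 * deriv^[1] κ s) • deriv c s
      + (deriv^[4] κ s - 15 * κ s * deriv^[1] κ s ^ 2 - 10 * κ s ^ 2 * deriv^[2] κ s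
        + κ s ^ 5) • quarterTurn (deriv c s) := fun s hs => by
    rw [h.covIter_succ c4
      (fun t ht => ((((hd 1 ht).fun_pow 2).const_mul (-3)).fun_sub
        (((hd0 ht).const_mul 4).fun_mul (hd 2 ht))).fun_add ((hd0 ht).fun_pow 4))
      (fun t ht => (hd 3 ht).fun_sub ((((hd0 ht).fun_pow 2).const_mul 6).fun_mul (hd 1 ht))) s hs,
      hκ]
    congr 2 <;> push_cast <;> ring
  have h0 := (h.pos s hs).ne'
  have hw := h.speed_sq hs
  -- The curvature terms are purely normal: `R(∇³T, T)T` is `ρ` times the normal part of `∇³T`, that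
  -- is `ρ(κ'' - κ³)JT`, and `R(∇²T, ∇T)T = ρκ³ JT`.
  rw [tension3, riemann_confMetric h0, riemann_confMetric h0, c0, c1 s hs, c2 s hs, c3 s hs,
    c5 s hs]
  simp only [scal_confMetric]
  ext k
  simp
  field_simp
  rw [← hw]
  ring

lemma geodCurv_of_tension3_eq_zero (h : IsConfCurve ρ c U)
    (ht : ∀ s ∈ U, tension3 (confMetric ρ) c s = 0) {s : ℝ} (hs : s ∈ U) :
    geodCurv (confMetric ρ) c s = 0 ∨ geodCurv (confMetric ρ) c s ^ 2 = 2 * ρ := by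
  set κ := geodCurv (confMetric ρ) c with hκ
  have hode := fun s hs => (h.frame_eq_zero_iff hs).1 ((h.tension3_eq hκ.symm hs).symm.trans
    (ht s hs))
  have hd := deriv_eq_zero_of_triharmonic_ode h.isOpen h.contDiffOn_geodCurv
    (fun s hs => (hode s hs).1) (fun s hs => (hode s hs).2)
  have hz (m : ℕ) : deriv^[m + 1] κ s = 0 := eqOn_iterate_deriv_zero h.isOpen hd m hs
  have := (hode s hs).2
  rw [hz 0, hz 1, hz 3] at this
  -- With all derivatives of `κ` zero, only `κ⁵ - 2ρκ³` survives in the normal part.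
  have h3 : κ s ^ 3 * (κ s ^ 2 - 2 * ρ) = 0 := by linear_combination this
  rcases mul_eq_zero.1 h3 with h3 | h3
  · exact Or.inl (pow_eq_zero_iff (by norm_num) |>.1 h3)
  · exact Or.inr (sub_eq_zero.1 h3)

lemma tension3_eq_zero_of_geodCurv_sq (h : IsConfCurve ρ c U) {a : ℝ} (ha : a = 0 ∨ a = 2 * ρ)
    (hκ : ∀ s ∈ U, geodCurv (confMetric ρ) c s ^ 2 = a) {s : ℝ} (hs : s ∈ U) :
    tension3 (confMetric ρ) c s = 0 := by
  set κ := geodCurv (confMetric ρ) c with hκ'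
  have hd := deriv_eq_zero_of_sq_eq h.isOpen h.contDiffOn_geodCurv hκ
  have hz (m : ℕ) : deriv^[m + 1] κ s = 0 := eqOn_iterate_deriv_zero h.isOpen hd m hs
  rw [h.tension3_eq hκ'.symm hs, h.frame_eq_zero_iff hs, hz 0, hz 1, hz 2, hz 3]
  refine ⟨by ring, ?_⟩
  have := hκ s hs
  rcases ha with rfl | rfl
  · have : κ s = 0 := by simpa using this
    simp [this]
  · linear_combination κ s ^ 3 * this

lemma covIter_one_eq_zero_iff (h : IsConfCurve ρ c U) {s : ℝ} (hs : s ∈ U) :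
    covIter (confMetric ρ) c 1 s = 0 ↔ geodCurv (confMetric ρ) c s = 0 := by
  have := h.frame_eq_zero_iff hs (a := 0) (b := geodCurv (confMetric ρ) c s)
  rw [h.covIter_one hs]
  simpa using this

/-- In curvature `ρ ≤ 0`, a unit speed curve is triharmonic exactly if it is a geodesic. -/
lemma tension3_eq_zero_iff_of_nonpos (h : IsConfCurve ρ c U) (hρ : ρ ≤ 0) :
    (∀ s ∈ U, tension3 (confMetric ρ) c s = 0) ↔ ∀ s ∈ U, covIter (confMetric ρ) c 1 s = 0 := by
  constructor
  · intro ht s hs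
    rw [h.covIter_one_eq_zero_iff hs]
    rcases h.geodCurv_of_tension3_eq_zero ht hs with h0 | h0
    · exact h0
    · nlinarith [sq_nonneg (geodCurv (confMetric ρ) c s)]
  · intro hg s hs
    refine h.tension3_eq_zero_of_geodCurv_sq (Or.inl rfl) (fun t ht => ?_) hs
    simpa using (h.covIter_one_eq_zero_iff ht).1 (hg t ht)

end IsConfCurve

/-! ### From conformal charts to the three surfaces -/

namespace RiemannianSurface

variable {M : Type} [TopologicalSpace M]

/-- All charts of `S` are conformal charts of curvature `ρ`. -/
structure IsConformal (S : RiemannianSurface M) (ρ : ℝ) : Prop where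
  metric_eq : ∀ i, S.metric i = confMetric ρ
  pos : ∀ i, ∀ x ∈ (S.chart i).target, 0 < confDenom ρ x

variable {S : RiemannianSurface M} {ρ : ℝ} {γ : ℝ → M} {I : Set ℝ}

lemma IsConformal.isConfCurve (hS : S.IsConformal ρ) (hI : IsOpen I)
    (hγ : S.IsArcLengthCurve γ I) (i : S.ι) :
    IsConfCurve ρ (S.coord i γ) (I ∩ γ ⁻¹' (S.chart i).source) where
  isOpen := hγ.continuousOn.isOpen_inter_preimage hI (S.chart i).open_source
  smooth := hγ.smooth i
  pos _ hs := hS.pos i _ ((S.chart i).map_source hs.2)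
  unit_speed _ hs := hS.metric_eq i ▸ hγ.unit_speed i _ hs.1 hs.2

lemma IsConformal.isTriharmonic_iff_of_nonpos (hS : S.IsConformal ρ) (hρ : ρ ≤ 0) (hI : IsOpen I)
    (hγ : S.IsArcLengthCurve γ I) : S.IsTriharmonic γ I ↔ S.IsGeodesic γ I := by
  refine forall_congr' fun i => ?_
  simpa [hS.metric_eq i] using (hS.isConfCurve hI hγ i).tension3_eq_zero_iff_of_nonpos hρ

end RiemannianSurface

lemma isConformal_euclideanPlane : euclideanPlane.IsConformal 0 where
  metric_eq _ := by
    funext x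
    simp [confMetric, conformalFactor, euclideanPlane, RiemannianSurface.ofChart]
  pos _ x _ := by simp [confDenom]

lemma isConformal_hyperbolicPlane (ρ : ℝ) : (hyperbolicPlane ρ).IsConformal ρ where
  metric_eq _ := rfl
  pos _ _ hx := hx

lemma isConformal_roundSphere {R : ℝ} (hR : 0 < R) :
    (roundSphere hR).IsConformal (1 / R ^ 2) where
  metric_eq i := funext fun x => firstFundamentalForm_stereoInv hR i x
  pos _ x _ := by simp only [confDenom]; positivity


/-! ### Curves on the sphere seen in the ambient space -/

lemma hasDerivAt_euclideanSpace {n : ℕ} {F : ℝ → EuclideanSpace ℝ (Fin n)}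
    {F' : EuclideanSpace ℝ (Fin n)} {s : ℝ} (h : ∀ k, HasDerivAt (fun t => F t k) (F' k) s) :
    HasDerivAt F F' s :=
  (EuclideanSpace.equiv (Fin n) ℝ).symm.hasFDerivAt.comp_hasDerivAt s (hasDerivAt_pi.2 h)

lemma inner_fderiv_stereoInv {R : ℝ} (hR : 0 < R) (ε : ℤˣ) (x v w : Fin 2 → ℝ) :
    inner ℝ (fderiv ℝ (stereoInv R ε) x v) (fderiv ℝ (stereoInv R ε) x w) =
      scal (confMetric (1 / R ^ 2)) x v w := by
  have key (w : Fin 2 → ℝ) : fderiv ℝ (stereoInv R ε) x w =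
      w 0 • fderiv ℝ (stereoInv R ε) x (Pi.single 0 1)
        + w 1 • fderiv ℝ (stereoInv R ε) x (Pi.single 1 1) := by
    rw [← map_smul, ← map_smul, ← map_add]
    congr 1
    ext i
    fin_cases i <;> simp
  have hg : confMetric (1 / R ^ 2) x = firstFundamentalForm (stereoInv R ε) x :=
    (firstFundamentalForm_stereoInv hR ε x).symm
  rw [key v, key w, scal, hg]
  simp only [inner_add_left, inner_add_right, real_inner_smul_left, real_inner_smul_right,
    firstFundamentalForm, Matrix.of_apply, Fin.sum_univ_two]
  ring

lemma inner_stereoInv_self {R : ℝ} (hR : 0 < R) (ε : ℤˣ) (x : Fin 2 → ℝ) :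
    inner ℝ (stereoInv R ε x) (stereoInv R ε x) = R ^ 2 := by
  rw [real_inner_self_eq_norm_sq, mem_sphere_zero_iff_norm.1 (stereoInv_mem hR ε x)]

/-- The position vector is normal to the sphere. -/
lemma inner_fderiv_stereoInv_stereoInv {R : ℝ} (hR : 0 < R) (ε : ℤˣ) (x v : Fin 2 → ℝ) :
    inner ℝ (fderiv ℝ (stereoInv R ε) x v) (stereoInv R ε x) = 0 := by
  have h : x 0 ^ 2 + x 1 ^ 2 + 4 * R ^ 2 ≠ 0 := by positivity
  have e := sign_sq ε
  rw [fderiv_stereoInv hR, inner_sub_left, real_inner_smul_left (stereoInv R ε x),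
    inner_stereoInv_self hR, inner_eq_three]
  simp [stereoInv]
  field_simp
  simp only [e]
  ring

/-- The Gauss formula for the sphere, in stereographic coordinates. -/
lemma hasDerivAt_fderiv_stereoInv {R : ℝ} (hR : 0 < R) (ε : ℤˣ) {c V : ℝ → Fin 2 → ℝ} {s : ℝ}
    (hc : DifferentiableAt ℝ c s) (hV : DifferentiableAt ℝ V s) :
    HasDerivAt (fun t => fderiv ℝ (stereoInv R ε) (c t) (V t))
      (fderiv ℝ (stereoInv R ε) (c s) (covDeriv (confMetric (1 / R ^ 2)) c V s)
        - (1 / R ^ 2 * scal (confMetric (1 / R ^ 2)) (c s) (deriv c s) (V s)) •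
          stereoInv R ε (c s)) s := by
  have hq : c s 0 ^ 2 + c s 1 ^ 2 + 4 * R ^ 2 ≠ 0 := by positivity
  have e := sign_sq ε
  have hw : confDenom (1 / R ^ 2) (c s) = (c s 0 ^ 2 + c s 1 ^ 2 + 4 * R ^ 2) / (4 * R ^ 2) := by
    simp only [confDenom]; field_simp; ring
  have hw0 : confDenom (1 / R ^ 2) (c s) ≠ 0 := by rw [hw]; positivity
  have hc' := hasDerivAt_pi.1 hc.hasDerivAt
  have hV' := hasDerivAt_pi.1 hV.hasDerivAt
  have hQ := (((hc' 0).fun_pow 2).fun_add ((hc' 1).fun_pow 2)).add_const (4 * R ^ 2)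
  have hxv := (((hc' 0).const_mul 2).fun_mul (hV' 0)).fun_add
    (((hc' 1).const_mul 2).fun_mul (hV' 1))
  have hd := hxv.fun_div hQ hq
  have hn (k : Fin 3) : HasDerivAt (fun t => stereoInv R ε (c t) k)
      (fderiv ℝ (stereoInv R ε) (c s) (deriv c s) k) s :=
    (EuclideanSpace.proj (𝕜 := ℝ) k).hasFDerivAt.comp_hasDerivAt s
      ((((contDiff_stereoInv hR ε).differentiable (by simp) (c s)).hasFDerivAt).comp_hasDerivAt s
        hc.hasDerivAt)
  refine hasDerivAt_euclideanSpace fun k => ?_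
  -- A component of the differential is `N/Q - (2⟨x, v⟩/Q)` times that of `stereoInv`, with `Q =
  -- |x|² + 4R²` and only the numerator `N` depending on the component.
  have key {N : ℝ → ℝ} {N' : ℝ} (hN : HasDerivAt N N' s) :=
    ((hQ.fun_inv hq).fun_mul hN).fun_sub (hd.fun_mul (hn k))
  have hcd := covDeriv_confMetric hw0 V
  simp only [fderiv_stereoInv hR, scal_confMetric, hw] at key hcd ⊢
  generalize covDeriv (confMetric (1 / R ^ 2)) c V s = W at hcd ⊢
  fin_cases k
  · refine (key ((hV' 0).const_mul (4 * R ^ 2))).congr_deriv ?_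
    simp [stereoInv, hcd]
    field_simp
    ring
  · refine (key (((hV' 1).const_mul (4 * R ^ 2)).const_mul (ε : ℝ))).congr_deriv ?_
    simp [stereoInv, hcd]
    field_simp
    ring
  · refine (key ((hxv.const_mul R).const_mul (ε : ℝ))).congr_deriv ?_
    simp [stereoInv, hcd]
    field_simp
    ring

lemma IsConfCurve.differentiableAt {ρ : ℝ} {c : ℝ → Fin 2 → ℝ} {U : Set ℝ}
    (h : IsConfCurve ρ c U) {s : ℝ} (hs : s ∈ U) : DifferentiableAt ℝ c s :=
  (hasDerivAt_pi.2 (h.hasDerivAt hs)).differentiableAt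

/-- A curve on the sphere which is written as `c` in a stereographic chart. -/
lemma IsConfCurve.hasDerivAt_stereoInv {R : ℝ} (hR : 0 < R) (ε : ℤˣ) {c : ℝ → Fin 2 → ℝ}
    {U : Set ℝ} (h : IsConfCurve (1 / R ^ 2) c U) {s : ℝ} (hs : s ∈ U) :
    HasDerivAt (fun t => stereoInv R ε (c t)) (fderiv ℝ (stereoInv R ε) (c s) (deriv c s)) s :=
  (((contDiff_stereoInv hR ε).differentiable (by simp) (c s)).hasFDerivAt).comp_hasDerivAt s
    (h.differentiableAt hs).hasDerivAt

/-- The Gauss formula with `V = T`: tangential acceleration `∇_T T`, normal acceleration `-γ/R²`. -/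
lemma IsConfCurve.deriv_deriv_stereoInv {R : ℝ} (hR : 0 < R) (ε : ℤˣ) {c : ℝ → Fin 2 → ℝ}
    {U : Set ℝ} (h : IsConfCurve (1 / R ^ 2) c U) {s : ℝ} (hs : s ∈ U) :
    deriv (deriv fun t => stereoInv R ε (c t)) s =
      fderiv ℝ (stereoInv R ε) (c s) (covIter (confMetric (1 / R ^ 2)) c 1 s)
        - (1 / R ^ 2) • stereoInv R ε (c s) := by
  have he : deriv (fun t => stereoInv R ε (c t)) =ᶠ[nhds s]
      fun t => fderiv ℝ (stereoInv R ε) (c t) (deriv c t) :=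
    Filter.eventuallyEq_of_mem (h.isOpen.mem_nhds hs)
      fun t ht => (h.hasDerivAt_stereoInv hR ε ht).deriv
  have := hasDerivAt_fderiv_stereoInv hR ε
    (h.differentiableAt hs)
    (h.hasDerivAt_deriv hs).differentiableAt
  rw [he.deriv_eq, this.deriv, h.unit_speed s hs, mul_one]
  rfl

/-- The acceleration in `ℝ³` of a unit speed curve on the sphere. -/
lemma IsConfCurve.inner_deriv_deriv_stereoInv {R : ℝ} (hR : 0 < R) (ε : ℤˣ) {c : ℝ → Fin 2 → ℝ}
    {U : Set ℝ} (h : IsConfCurve (1 / R ^ 2) c U) {s : ℝ} (hs : s ∈ U) :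
    inner ℝ (deriv (deriv fun t => stereoInv R ε (c t)) s)
        (deriv (deriv fun t => stereoInv R ε (c t)) s) =
      geodCurv (confMetric (1 / R ^ 2)) c s ^ 2 + 1 / R ^ 2 ∧
    inner ℝ (deriv (deriv fun t => stereoInv R ε (c t)) s) (stereoInv R ε (c s)) = -1 := by
  have hw := h.speed_sq hs
  have h0 := (h.pos s hs).ne'
  rw [h.deriv_deriv_stereoInv hR ε hs]
  have h1 := inner_fderiv_stereoInv_stereoInv hR ε (c s) (covIter (confMetric (1 / R ^ 2)) c 1 s)
  have h2 := inner_stereoInv_self hR ε (c s)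
  have h3 := inner_fderiv_stereoInv hR ε (c s) (covIter (confMetric (1 / R ^ 2)) c 1 s)
    (covIter (confMetric (1 / R ^ 2)) c 1 s)
  have h4 : scal (confMetric (1 / R ^ 2)) (c s) (covIter (confMetric (1 / R ^ 2)) c 1 s)
      (covIter (confMetric (1 / R ^ 2)) c 1 s) = geodCurv (confMetric (1 / R ^ 2)) c s ^ 2 := by
    rw [scal_confMetric, h.covIter_one hs, div_eq_iff (pow_ne_zero 2 h0), ← hw]
    simp
    ring
  rw [h4] at h3
  simp only [inner_sub_left, inner_sub_right, real_inner_smul_left, real_inner_smul_right, h1, h2,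
    h3, real_inner_comm (fderiv ℝ (stereoInv R ε) (c s) _) (stereoInv R ε (c s))]
  constructor <;> field_simp <;> ring

/-- A curve on the sphere with `κ² = 2ρ` solves a linear equation in `ℝ³`. -/
lemma IsConfCurve.hasDerivAt_deriv_deriv_stereoInv {R : ℝ} (hR : 0 < R) (ε : ℤˣ)
    {c : ℝ → Fin 2 → ℝ} {U : Set ℝ} (h : IsConfCurve (1 / R ^ 2) c U)
    (hκ : ∀ s ∈ U, geodCurv (confMetric (1 / R ^ 2)) c s ^ 2 = 2 * (1 / R ^ 2))
    {s : ℝ} (hs : s ∈ U) :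
    HasDerivAt (fun t => deriv (deriv fun t => stereoInv R ε (c t)) t
      + (3 * (1 / R ^ 2)) • stereoInv R ε (c t)) 0 s := by
  have hT := h.hasDerivAt_deriv hs
  have hk : HasDerivAt (geodCurv (confMetric (1 / R ^ 2)) c)
      (deriv (geodCurv (confMetric (1 / R ^ 2)) c) s) s :=
    hasDerivAt_iterate_deriv h.isOpen h.contDiffOn_geodCurv 0 hs
  have hk0 : deriv (geodCurv (confMetric (1 / R ^ 2)) c) s = 0 :=
    deriv_eq_zero_of_sq_eq h.isOpen h.contDiffOn_geodCurv hκ hs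
  have hN := hasDerivAt_quarterTurn hT
  -- `V = κJT = ∇_T T`, with the zero `T` component kept to fit `covDeriv_frame`. As `κ` is
  -- constant, `∇_T V = -κ²T = -2ρT`, and `V ⟂ T` kills the normal term of the Gauss formula; hence
  -- `V + 2ργ = γ'' + 3ργ` has derivative zero.
  set V : ℝ → Fin 2 → ℝ := fun t => (0 : ℝ) • deriv c t
    + geodCurv (confMetric (1 / R ^ 2)) c t • quarterTurn (deriv c t) with hV
  have hVd : DifferentiableAt ℝ V s :=
    ((hT.differentiableAt.const_smul (0 : ℝ)).add (hk.fun_smul hN).differentiableAt)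
  have hVc : covDeriv (confMetric (1 / R ^ 2)) c V s = -(2 * (1 / R ^ 2)) • deriv c s := by
    rw [h.covDeriv_frame hs (hasDerivAt_const s 0) hk, ← hκ s hs]
    simp only [hk0]
    simp [pow_two]
  have hVs : scal (confMetric (1 / R ^ 2)) (c s) (deriv c s) (V s) = 0 := by
    rw [scal_confMetric]
    simp [hV]
    exact Or.inl (by ring)
  have he : (fun t => deriv (deriv fun t => stereoInv R ε (c t)) t
      + (3 * (1 / R ^ 2)) • stereoInv R ε (c t)) =ᶠ[nhds s]
      fun t => fderiv ℝ (stereoInv R ε) (c t) (V t) + (2 * (1 / R ^ 2)) • stereoInv R ε (c t) := by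
    refine Filter.eventuallyEq_of_mem (h.isOpen.mem_nhds hs) fun t ht => ?_
    simp only [h.deriv_deriv_stereoInv hR ε ht, h.covIter_one ht, hV, zero_smul, zero_add]
    module
  have hG := hasDerivAt_fderiv_stereoInv hR ε
    (h.differentiableAt hs) hVd
  refine HasDerivAt.congr_of_eventuallyEq ?_ he
  refine (hG.fun_add ((h.hasDerivAt_stereoInv hR ε hs).fun_const_smul
    (2 * (1 / R ^ 2)))).congr_deriv ?_
  simp only [hVc, hVs, map_smul]
  module

/-! ### Triharmonic curves on the round sphere -/

section RoundSphere

variable {R : ℝ} {hR : 0 < R} {γ : ℝ → Sphere R} {I : Set ℝ}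

lemma eqOn_stereoInv_coord (ε : ℤˣ) :
    Set.EqOn (fun t => (γ t).1) (fun t => stereoInv R ε ((roundSphere hR).coord ε γ t))
      (I ∩ γ ⁻¹' ((roundSphere hR).chart ε).source) := fun _ ht =>
  (stereoInv_stereoFun hR ε _ ht.2).symm

lemma RiemannianSurface.IsArcLengthCurve.contDiffOn_coe
    (hγ : (roundSphere hR).IsArcLengthCurve γ I) (hI : IsOpen I) :
    ContDiffOn ℝ ∞ (fun t => (γ t).1) I := by
  intro s hs
  obtain ⟨ε, hε⟩ := (roundSphere hR).cover (γ s)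
  have h := (isConformal_roundSphere hR).isConfCurve hI hγ ε
  refine (ContDiffOn.contDiffAt (f := fun t => (γ t).1) ?_
    (h.isOpen.mem_nhds ⟨hs, hε⟩)).contDiffWithinAt
  exact ((contDiff_stereoInv hR ε).comp_contDiffOn h.smooth).congr (eqOn_stereoInv_coord ε)

/-- The left-hand sides do not mention the chart; this is what lets `κ²` be followed from one chart
to the other. -/
lemma RiemannianSurface.IsArcLengthCurve.inner_deriv_deriv_coe
    (hγ : (roundSphere hR).IsArcLengthCurve γ I) (hI : IsOpen I) {ε : ℤˣ} {s : ℝ} (hs : s ∈ I)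
    (hε : γ s ∈ ((roundSphere hR).chart ε).source) :
    inner ℝ (deriv (deriv fun t => (γ t).1) s) (deriv (deriv fun t => (γ t).1) s) =
      geodCurv ((roundSphere hR).metric ε) ((roundSphere hR).coord ε γ) s ^ 2 + 1 / R ^ 2 ∧
    inner ℝ (deriv (deriv fun t => (γ t).1) s) (γ s).1 = -1 := by
  have h := (isConformal_roundSphere hR).isConfCurve hI hγ ε
  have he : (fun t => (γ t).1) =ᶠ[nhds s] fun t => stereoInv R ε ((roundSphere hR).coord ε γ t) :=
    (eqOn_stereoInv_coord ε).eventuallyEq_of_mem (h.isOpen.mem_nhds ⟨hs, hε⟩)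
  have hval : (γ s).1 = stereoInv R ε ((roundSphere hR).coord ε γ s) := he.eq_of_nhds
  have hm : geodCurv ((roundSphere hR).metric ε) ((roundSphere hR).coord ε γ) s =
      geodCurv (confMetric (1 / R ^ 2)) ((roundSphere hR).coord ε γ) s :=
    congrArg (fun g => geodCurv g _ s) ((isConformal_roundSphere hR).metric_eq ε)
  rw [he.deriv.deriv_eq, hm, hval]
  exact h.inner_deriv_deriv_stereoInv hR ε ⟨hs, hε⟩

/-- A unit speed curve on the sphere of curvature `ρ` with `κ² = 2ρ` lies on a circle. -/
lemma RiemannianSurface.IsArcLengthCurve.liesOnCircle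
    (hγ : (roundSphere hR).IsArcLengthCurve γ I) (hI : IsOpen I) (hI' : I.OrdConnected)
    (hne : I.Nonempty) (hκ : (roundSphere hR).HasGeodCurvSq γ I (2 * (1 / R ^ 2))) :
    LiesOnCircle γ I := by
  obtain ⟨s, hs⟩ := hne
  set b : EuclideanSpace ℝ (Fin 3) :=
    deriv (deriv fun t => (γ t).1) s + (3 * (1 / R ^ 2)) • (γ s).1 with hb
  have hd : ∀ t ∈ I, HasDerivAt (fun t => deriv (deriv fun t => (γ t).1) t
      + (3 * (1 / R ^ 2)) • (γ t).1) 0 t := by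
    intro t ht
    obtain ⟨ε, hε⟩ := (roundSphere hR).cover (γ t)
    have h := (isConformal_roundSphere hR).isConfCurve hI hγ ε
    have he : (fun t => (γ t).1) =ᶠ[nhds t]
        fun t => stereoInv R ε ((roundSphere hR).coord ε γ t) :=
      (eqOn_stereoInv_coord ε).eventuallyEq_of_mem (h.isOpen.mem_nhds ⟨ht, hε⟩)
    refine (h.hasDerivAt_deriv_deriv_stereoInv hR ε (fun r hr => ?_)
      ⟨ht, hε⟩).congr_of_eventuallyEq (he.deriv.deriv.add (he.const_smul (3 * (1 / R ^ 2))))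
    simpa only [(isConformal_roundSphere hR).metric_eq] using hκ ε r hr.1 hr.2
  have hconst : ∀ t ∈ I, deriv (deriv fun t => (γ t).1) t + (3 * (1 / R ^ 2)) • (γ t).1 = b :=
    fun t ht => hI.is_const_of_deriv_eq_zero hI'.isPreconnected
      (fun r hr => (hd r hr).differentiableAt.differentiableWithinAt)
      (fun r hr => (hd r hr).deriv) ht hs
  have hG (t : ℝ) : inner ℝ (γ t).1 (γ t).1 = R ^ 2 := by
    rw [real_inner_self_eq_norm_sq, mem_sphere_zero_iff_norm.1 (γ t).2]
  have hGb : ∀ t ∈ I, inner ℝ (γ t).1 b = 2 := by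
    intro t ht
    obtain ⟨ε, hε⟩ := (roundSphere hR).cover (γ t)
    have h2 := (hγ.inner_deriv_deriv_coe hI ht hε).2
    rw [real_inner_comm, ← hconst t ht, inner_add_left, real_inner_smul_left, h2, hG]
    field_simp
    norm_num
  have hbb : inner ℝ b b = 6 * (1 / R ^ 2) := by
    obtain ⟨ε, hε⟩ := (roundSphere hR).cover (γ s)
    obtain ⟨h1, h2⟩ := hγ.inner_deriv_deriv_coe hI hs hε
    rw [hκ ε s hs hε] at h1
    rw [hb]
    simp only [inner_add_left, inner_add_right, real_inner_smul_left, real_inner_smul_right,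
      real_inner_comm (deriv (deriv fun t => (γ t).1) s) (γ s).1, h1, h2, hG]
    field_simp
    norm_num
  have hb0 : 0 < ‖b‖ := by
    refine norm_pos_iff.2 fun h0 => ?_
    rw [h0, inner_zero_left] at hbb
    have : 0 < 6 * (1 / R ^ 2) := by positivity
    exact this.ne hbb
  -- The centre of the circle is where the ray spanned by `b` meets the sphere; `⟨γ, b⟩ = 2` then
  -- fixes the distance to it.
  have hp : (R / ‖b‖) • b ∈ Metric.sphere (0 : EuclideanSpace ℝ (Fin 3)) R := by
    rw [mem_sphere_zero_iff_norm, norm_smul, norm_div, norm_norm, Real.norm_of_nonneg hR.le,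
      div_mul_cancel₀ _ hb0.ne']
  set p : Sphere R := ⟨(R / ‖b‖) • b, hp⟩
  have hdist : ∀ t ∈ I, dist (γ t) p ^ 2 = 2 * R ^ 2 - 4 * (R / ‖b‖) := by
    intro t ht
    rw [Subtype.dist_eq, dist_eq_norm, norm_sub_sq_real, mem_sphere_zero_iff_norm.1 (γ t).2,
      mem_sphere_zero_iff_norm.1 p.2, real_inner_smul_right, hGb t ht]
    ring
  refine ⟨p, dist (γ s) p, dist_pos.2 fun h => ?_, fun t ht => ?_⟩
  -- If the radius were zero, `γ s` would be the positive multiple of `b` of length `R`, so `R‖b‖ =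
  -- ⟨γ, b⟩ = 2`, against `R²‖b‖² = 6`.
  · have h1 := hGb s hs
    have h2 : inner ℝ (γ s).1 b = R / ‖b‖ * inner ℝ b b := by rw [h, real_inner_smul_left]
    rw [h2, real_inner_self_eq_norm_sq] at h1
    rw [real_inner_self_eq_norm_sq] at hbb
    have h3 : R * ‖b‖ = 2 := by rw [← h1]; field_simp
    have h4 : (R * ‖b‖) ^ 2 = 6 := by rw [mul_pow, hbb]; field_simp
    rw [h3] at h4
    norm_num at h4
  · exact (sq_eq_sq₀ dist_nonneg dist_nonneg).1 ((hdist t ht).trans (hdist s hs).symm)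

theorem isTriharmonic_roundSphere_iff (hγ : (roundSphere hR).IsArcLengthCurve γ I)
    (hI : IsOpen I) (hI' : I.OrdConnected) :
    (roundSphere hR).IsTriharmonic γ I ↔ (roundSphere hR).IsGeodesic γ I ∨
      (LiesOnCircle γ I ∧ (roundSphere hR).HasGeodCurvSq γ I (2 * (1 / R ^ 2))) := by
  have hS := isConformal_roundSphere hR
  have hconf := hS.isConfCurve hI hγ
  constructor
  · intro ht
    rcases I.eq_empty_or_nonempty with rfl | ⟨s, hs⟩
    · exact Or.inl fun _ _ h => absurd h (Set.notMem_empty _)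
    -- A chart-free expression for `κ²`, continuous on all of `I`. With values in `{0, 2ρ}` it is
    -- constant, so the curve cannot switch between the two alternatives.
    set K : ℝ → ℝ := fun t =>
      inner ℝ (deriv (deriv fun t => (γ t).1) t) (deriv (deriv fun t => (γ t).1) t) - 1 / R ^ 2
      with hK
    have hKκ : ∀ ε, ∀ t ∈ I, γ t ∈ ((roundSphere hR).chart ε).source →
        geodCurv ((roundSphere hR).metric ε) ((roundSphere hR).coord ε γ) t ^ 2 = K t :=
      fun ε t ht hε => by
        simp only [hK]
        linear_combination -(hγ.inner_deriv_deriv_coe hI ht hε).1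
    have hKc : ContinuousOn K I := by
      have := (contDiffOn_iterate_deriv hI (hγ.contDiffOn_coe hI) 2).continuousOn
      exact (this.inner this).sub continuousOn_const
    have hKv : ∀ t ∈ I, K t = 0 ∨ K t = 2 * (1 / R ^ 2) := by
      intro t htI
      obtain ⟨ε, hε⟩ := (roundSphere hR).cover (γ t)
      have h1 := (hconf ε).geodCurv_of_tension3_eq_zero
        (fun r hr => hS.metric_eq ε ▸ ht ε r hr.1 hr.2) ⟨htI, hε⟩
      rw [← hKκ ε t htI hε, hS.metric_eq]
      simpa using h1
    have hKconst : ∀ t ∈ I, K t = K s := by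
      generalize 2 * (1 / R ^ 2) = a at hKv
      have hp : (Polynomial.X * (Polynomial.X - Polynomial.C a) : Polynomial ℝ) ≠ 0 :=
        mul_ne_zero Polynomial.X_ne_zero (Polynomial.X_sub_C_ne_zero a)
      refine eqOn_const_of_eval_eq_zero hI'.isPreconnected hKc hp (fun t ht => ?_) hs
      rw [Polynomial.eval_mul, Polynomial.eval_sub, Polynomial.eval_X, Polynomial.eval_C]
      exact mul_eq_zero.2 ((hKv t ht).imp_right sub_eq_zero.2)
    rcases hKv s hs with h | h
    · refine Or.inl fun ε t htI hε => ?_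
      have h1 := hKκ ε t htI hε
      rw [hKconst t htI, h, hS.metric_eq] at h1
      rw [hS.metric_eq, (hconf ε).covIter_one_eq_zero_iff ⟨htI, hε⟩]
      exact pow_eq_zero_iff two_ne_zero |>.1 h1
    · have hg : (roundSphere hR).HasGeodCurvSq γ I (2 * (1 / R ^ 2)) := fun ε t htI hε => by
        rw [hKκ ε t htI hε, hKconst t htI, h]
      exact Or.inr ⟨hγ.liesOnCircle hI hI' ⟨s, hs⟩ hg, hg⟩
  · rintro (hg | ⟨-, hg⟩) ε s hs hε <;> rw [hS.metric_eq]
    · refine (hconf ε).tension3_eq_zero_of_geodCurv_sq (Or.inl rfl) (fun t ht => ?_) ⟨hs, hε⟩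
      have := hS.metric_eq ε ▸ hg ε t ht.1 ht.2
      simpa using ((hconf ε).covIter_one_eq_zero_iff ht).1 this
    · exact (hconf ε).tension3_eq_zero_of_geodCurv_sq (Or.inr rfl)
        (fun t ht => hS.metric_eq ε ▸ hg ε t ht.1 ht.2) ⟨hs, hε⟩

end RoundSphere

end Triharmonic

theorem mainTheorem12 (I : Set ℝ) (hI : IsOpen I) (hI' : I.OrdConnected) :
    (∀ γ : ℝ → EuclideanSpace ℝ (Fin 2), Triharmonic.euclideanPlane.IsArcLengthCurve γ I →
      (Triharmonic.euclideanPlane.IsTriharmonic γ I ↔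
        Triharmonic.euclideanPlane.IsGeodesic γ I)) ∧
    (∀ ρ : ℝ, ρ < 0 → ∀ γ : ℝ → Triharmonic.PoincareDisc ρ,
      (Triharmonic.hyperbolicPlane ρ).IsArcLengthCurve γ I →
      ((Triharmonic.hyperbolicPlane ρ).IsTriharmonic γ I ↔
        (Triharmonic.hyperbolicPlane ρ).IsGeodesic γ I)) ∧
    (∀ (ρ : ℝ) (hρ : 0 < ρ) (γ : ℝ → Triharmonic.Sphere (1 / √ρ)),
      (Triharmonic.roundSphere (one_div_pos.2 (Real.sqrt_pos.2 hρ))).IsArcLengthCurve γ I →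
      ((Triharmonic.roundSphere (one_div_pos.2 (Real.sqrt_pos.2 hρ))).IsTriharmonic γ I ↔
        (Triharmonic.roundSphere (one_div_pos.2 (Real.sqrt_pos.2 hρ))).IsGeodesic γ I ∨
        (Triharmonic.LiesOnCircle γ I ∧
          (Triharmonic.roundSphere (one_div_pos.2 (Real.sqrt_pos.2 hρ))).HasGeodCurvSq γ I
            (2 * ρ)))) := by
  refine ⟨fun γ hγ => ?_, fun ρ hρ γ hγ => ?_, fun ρ hρ γ hγ => ?_⟩
  · exact Triharmonic.isConformal_euclideanPlane.isTriharmonic_iff_of_nonpos le_rfl hI hγ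
  · exact (Triharmonic.isConformal_hyperbolicPlane ρ).isTriharmonic_iff_of_nonpos hρ.le hI hγ
  · have h := Triharmonic.isTriharmonic_roundSphere_iff hγ hI hI'
    -- The curvature of the sphere of radius `1/√ρ`.
    have hR : 1 / (1 / √ρ) ^ 2 = ρ := by
      rw [div_pow, Real.sq_sqrt hρ.le]
      simp
    rwa [hR] at h
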